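/- **Theorem 3.2.** For an integer $N\ge 1$ let $V_N=\{-N,\dots,0,\dots,N\}$. For $\alpha\in[0,\infty)$ let $\hat\pi_\alpha$ and $\check\pi_\alpha$ be the probability measures on $V_N$ with $$\hat\pi_\alpha(x)\propto (N-|x|+1)^\alpha,\qquad \check\pi_\alpha(x)\propto(|x|+1)^\alpha .$$ Let $R$ be the symmetric simple random walk on $V_N$ with $R(x,y)=1/3$ if $|x-y|=1$, holding probability $R(x,x)=1/3$ for $|x|<N$ and $R(\pm N,\pm N)=2/3$. Let $\hat M_\alpha$ (resp. $\check M_\alpha$) be the Metropolis chain with base $R$ and target $\pi=\hat\pi_\alpha$ (resp. $\pi=\check\pi_\alpha$), that is, the Markov kernel with $M(x,y)=R(x,y)\min\{1,\pi(y)/\pi(x)\}$ for $y\ne x$ and $M(x,x)=1-\sum_{y\neq x}M(x,y)$. For a kernel $Q$ on $V_N$ and $\varepsilon\ge0$ let $\mathcal Q_N(Q,\varepsilon)=\{Q+\Delta_s: s\in[-\varepsilon,\varepsilon]\}$, where $\Delta_s(0,1)=s$, $\Delta_s(0,-1)=-s$ and $\Delta_s(x,y)=0$ otherwise. Set $\hat\varepsilon_{N,\alpha}=\frac16\left(\frac{N}{N+1}\right)^\alpha$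 and $\check\varepsilon_{N,\alpha}=\frac16$. For a sequence $(K_i)_{i\ge1}$ of Markov kernels on $V_N$ let $K_{0,n}=K_1K_2\cdots K_n$ (with $K_{0,0}=I$), and for $\eta>0$ let $$T_\infty(\eta)=\inf\Bigl\{n\ge0:\ \max_{x,y,z\in V_N}\Bigl|\frac{K_{0,n}(x,z)}{K_{0,n}(y,z)}-1\Bigr|<\eta\Bigr\},$$ with the conventions $0/0=1$, $a/0=\infty$ for $a>0$, and $\inf\emptyset=\infty$. Write $\log_+ t=\max\{0,\log t\}$. Fix $\alpha\in[0,\infty)$. 1. There is a constant $A\in(0,\infty)$, depending only on $\alpha$, such that for all $N\ge1$, every sequence $(K_i)_{i\ge1}$ with $K_i\in\mathcal Q_N(\hat M_\alpha,\hat\varepsilon_{N,\alpha})$ for all $i$, and every $\eta>0$, $$T_\infty(\eta)\le AN^2(1+\log_+ 1/\eta).$$ 2. For sequences $(K_i)_{i\ge1}$ with $K_i\in\mathcal Q_N(\check M_\alpha,\check\varepsilon_{N,\alpha})$ for all $i$, the following holds. * If $\alpha>1$, then for every $\eta_0\in(0,1)$ there is a constant $A\in(0,\infty)$, depending only on $\alpha$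 and $\eta_0$, such that for all $N\ge1$, all such sequences and all $\eta\in(0,\eta_0]$, $$T_\infty(\eta)\le A\bigl(N^2+N^{1+\alpha}\log_+1/\eta\bigr).$$ * If $\alpha=1$, then for every $\eta_0\in(0,1)$ there is a constant $A\in(0,\infty)$, depending only on $\eta_0$, such that for all $N\ge2$, all such sequences and all $\eta\in(0,\eta_0]$, $$T_\infty(\eta)\le A\bigl(N^2+(N^2\log N)\log_+1/\eta\bigr).$$ * If $\alpha<1$, then there is a constant $A\in(0,\infty)$, depending only on $\alpha$, such that for all $N\ge1$, all such sequences and all $\eta>0$, $$T_\infty(\eta)\le AN^2(1+\log_+1/\eta).$$ -/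

import Mathlib

open scoped ENNReal

noncomputable section

namespace BDMerging

/-- The vertex set `V_N = {-N, …, 0, …, N}`. -/
abbrev Vtx (N : ℕ) : Type := {x : ℤ // x ∈ Finset.Icc (-(N : ℤ)) (N : ℤ)}

section Merging

variable {V : Type*} [Fintype V] [DecidableEq V]

/-- The iterated kernel `K_{0,n} = K_1 K_2 ⋯ K_n` of the time inhomogeneous chain driven by
`K_1, K_2, …` (the value `K 0` is not used). -/
def iterKernel (K : ℕ → Matrix V V ℝ) : ℕ → Matrix V V ℝ
  | 0 => 1
  | n + 1 => iterKernel K n * K (n + 1)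

/-- `|a / b - 1|` with the conventions `0 / 0 = 1` and `a / 0 = ∞` for `a ≠ 0`. -/
def relDev (a b : ℝ) : ℝ≥0∞ :=
  if b = 0 then (if a = 0 then 0 else ⊤) else ENNReal.ofReal |a / b - 1|

/-- `max_{x,y,z} |K_{0,n}(x,z) / K_{0,n}(y,z) - 1|`. -/
def relSup (K : ℕ → Matrix V V ℝ) (n : ℕ) : ℝ≥0∞ :=
  ⨆ (x : V) (y : V) (z : V), relDev (iterKernel K n x z) (iterKernel K n y z)

/-- The relative-sup merging time
`T_∞(η) = inf {n : max_{x,y,z} |K_{0,n}(x,z) / K_{0,n}(y,z) - 1| < η}`;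
it is `∞` if there is no such `n`. -/
def mergingTime (K : ℕ → Matrix V V ℝ) (η : ℝ) : ℕ∞ :=
  ⨅ (n : ℕ) (_ : relSup K n < ENNReal.ofReal η), (n : ℕ∞)

/-- The Metropolis chain with symmetric base kernel `Q` and target `π`: a proposed move
`x → y`, `y ≠ x`, is accepted with probability `min (1, π y / π x)`, and the chain stays at `x`
otherwise. -/
def metropolis (Q : Matrix V V ℝ) (π : V → ℝ) : Matrix V V ℝ :=
  Matrix.of fun x y =>
    if y = x then 1 - ∑ z ∈ Finset.univ.erase x, Q x z * min 1 (π z / π x)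
    else Q x y * min 1 (π y / π x)

/-- The probability vector proportional to the weight `w`. -/
def normalized (w : V → ℝ) : V → ℝ := fun x => w x / ∑ y, w y

end Merging

/-- Symmetric simple random walk on `V_N` with holding `1/3`, except at the two end points, where
the holding is `2/3`. -/
def baseWalk (N : ℕ) : Matrix (Vtx N) (Vtx N) ℝ :=
  Matrix.of fun x y =>
    if y = x then (if |x.1| = (N : ℤ) then 2 / 3 else 1 / 3)
    else if |x.1 - y.1| = 1 then 1 / 3 else 0

/-- `π̂_α(x) ∝ (N - |x| + 1)^α`. -/
def piHat (α : ℝ) (N : ℕ) : Vtx N → ℝ :=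
  normalized fun x => ((N : ℝ) - |(x.1 : ℝ)| + 1) ^ α

/-- `π̌_α(x) ∝ (|x| + 1)^α`. -/
def piCheck (α : ℝ) (N : ℕ) : Vtx N → ℝ :=
  normalized fun x => (|(x.1 : ℝ)| + 1) ^ α

/-- The Metropolis chain `M̂_α` on `V_N`. -/
def MHat (α : ℝ) (N : ℕ) : Matrix (Vtx N) (Vtx N) ℝ := metropolis (baseWalk N) (piHat α N)

/-- The Metropolis chain `M̌_α` on `V_N`. -/
def MCheck (α : ℝ) (N : ℕ) : Matrix (Vtx N) (Vtx N) ℝ := metropolis (baseWalk N) (piCheck α N)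

/-- The perturbation at the middle vertex: `Δ_s(0, ±1) = ± s`, and `Δ_s = 0` elsewhere. -/
def midPerturb (N : ℕ) (s : ℝ) : Matrix (Vtx N) (Vtx N) ℝ :=
  Matrix.of fun x y =>
    if x.1 = 0 ∧ y.1 = 1 then s else if x.1 = 0 ∧ y.1 = -1 then -s else 0

/-- The perturbation set `{Q + Δ_s : s ∈ [-ε, ε]}`. -/
def perturbSet {N : ℕ} (Q : Matrix (Vtx N) (Vtx N) ℝ) (ε : ℝ) :
    Set (Matrix (Vtx N) (Vtx N) ℝ) :=
  {P | ∃ s ∈ Set.Icc (-ε) ε, P = Q + midPerturb N s}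

/-- `ε̂_{N,α} = (1/6) (N / (N + 1))^α`, which is half of `M̂_α(0, ±1)`. -/
def epsHat (α : ℝ) (N : ℕ) : ℝ := 1 / 6 * ((N : ℝ) / ((N : ℝ) + 1)) ^ α

/-- `ε̌_{N,α} = 1/6`, which is half of `M̌_α(0, ±1)`. -/
def epsCheck : ℝ := 1 / 6

end BDMerging

end

/-! Write `M` for the unperturbed chain, `σ` for the reflection and `o` for the middle vertex. A
perturbation only redistributes mass between the two neighbours of `o`, so it is invisible modulo
`σ`: by `iterKernel_fold` the products `K_{0,n}` and `M ^ n` have the same sums over `σ`-orbits. It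
therefore suffices to bound `M ^ n`, except that a lower bound on an orbit sum says nothing about
its single points.

Upper bound. Paths of comparable weight give a Faber–Krahn inequality, which with polynomial volume
growth becomes a Nash inequality at scales below `N`. Hence `M ^ n x z ≤ C π z` for even `n` of
order `N ^ 2`, and folding gives `2 C π z` for `K_{0,n}`.

Lower bound. From `o`, only the last visit to `o` matters, and the step taken there loses at most a
factor 2 (`pow_le_two_mul_iterKernel`). A Lyapunov function `W ≤ G` controls the hitting time of
`o`: used once for `M`, with reversibility, it bounds `K_{0,n} o z` from below, and used again for
the perturbed chain it carries this bound to every starting point. So `K_{0,T} x z ≥ π z / 24` for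
some `T` of order `G`.

Thus all column ratios over a block of length `T` are bounded by a constant, and a Doeblin argument
makes them tend to 1 geometrically in the number of blocks. The merging time is of order `G (1 +
log_+ 1/η)`. Only `G`, the time scale for reaching `o`, distinguishes the cases: it is of order `N ^
2` for `π̂`, and `N ^ (1 + α) ∑_{j ≤ N} j ^ (-α)` for `π̌`, where `o` sits in a valley of the
weight. -/

open scoped ENNReal

namespace BDMerging

/-! ### Reversible lazy kernels: powers, energy and Faber–Krahn. -/

section Abstract

variable {V : Type*} [Fintype V] [DecidableEq V]

/-- A Markov kernel that is reversible with respect to the positive probability vector `π` and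
has holding probability at least `1 / 3` everywhere. -/
structure LazyReversible (M : Matrix V V ℝ) (π : V → ℝ) : Prop where
  nonneg : ∀ x y, 0 ≤ M x y
  row_sum : ∀ x, ∑ y, M x y = 1
  pos : ∀ x, 0 < π x
  total : ∑ x, π x = 1
  rev : ∀ x y, π x * M x y = π y * M y x
  hold : ∀ x, 1 / 3 ≤ M x x

/-- Twice the Dirichlet form of a reversible kernel. -/
def energy (M : Matrix V V ℝ) (π : V → ℝ) (h : V → ℝ) : ℝ :=
  ∑ x, ∑ y, π x * M x y * (h x - h y) ^ 2

/-- Every vertex is the start of an injective path with `k` steps whose edges have conductance at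
least `π x / B`, and at every time at most two of these paths visit a given vertex. -/
def HasPaths (M : Matrix V V ℝ) (π : V → ℝ) (k : ℕ) (B : ℝ) : Prop :=
  ∃ γ : V → ℕ → V, (∀ x, γ x 0 = x) ∧ (∀ x, Set.InjOn (γ x) (Set.Iic k)) ∧
    (∀ x, ∀ j < k, π x ≤ B * (π (γ x j) * M (γ x j) (γ x (j + 1)))) ∧
    ∀ j < k, ∀ u, (Finset.univ.filter fun x => γ x j = u).card ≤ 2

/-- The right side is a variance. After recentring at `h x`, the atom `x` contributes nothing, so
Cauchy–Schwarz runs over mass at most `2 / 3`. -/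
lemma sum_mul_sq_sub_sq_ge {p h : V → ℝ} (hp : ∀ y, 0 ≤ p y) (hp1 : ∑ y, p y = 1) (x : V)
    (hx : 1 / 3 ≤ p x) :
    1 / 3 * ∑ y, p y * (h x - h y) ^ 2 ≤ ∑ y, p y * h y ^ 2 - (∑ y, p y * h y) ^ 2 := by
  have e1 : ∑ y, p y * h y ^ 2 - (∑ y, p y * h y) ^ 2
      = ∑ y, p y * (h x - h y) ^ 2 - (∑ y, p y * (h x - h y)) ^ 2 := by
    have a1 : ∑ y, p y * (h x - h y) = h x - ∑ y, p y * h y := by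
      simp only [mul_sub, Finset.sum_sub_distrib, ← Finset.sum_mul, hp1, one_mul]
    have a2 : ∑ y, p y * (h x - h y) ^ 2
        = h x ^ 2 - 2 * h x * ∑ y, p y * h y + ∑ y, p y * h y ^ 2 := by
      have : ∀ y, p y * (h x - h y) ^ 2
          = p y * h x ^ 2 - 2 * h x * (p y * h y) + p y * h y ^ 2 := fun y => by ring
      simp only [this, Finset.sum_add_distrib, Finset.sum_sub_distrib, ← Finset.sum_mul, hp1,
        ← Finset.mul_sum, one_mul]
    rw [a1, a2]; ring
  rw [e1]
  have e2 : ∑ y, p y * (h x - h y) = ∑ y ∈ Finset.univ.erase x, p y * (h x - h y) := by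
    rw [← Finset.add_sum_erase _ _ (Finset.mem_univ x)]; simp
  have e3 : ∑ y, p y * (h x - h y) ^ 2
      = ∑ y ∈ Finset.univ.erase x, p y * (h x - h y) ^ 2 := by
    rw [← Finset.add_sum_erase _ _ (Finset.mem_univ x)]; simp
  have e4 : ∑ y ∈ Finset.univ.erase x, p y ≤ 2 / 3 := by
    have := Finset.add_sum_erase Finset.univ p (Finset.mem_univ x)
    linarith
  have e5 : (∑ y ∈ Finset.univ.erase x, p y * (h x - h y)) ^ 2
      ≤ (∑ y ∈ Finset.univ.erase x, p y) * ∑ y ∈ Finset.univ.erase x, p y * (h x - h y) ^ 2 :=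
    Finset.sum_sq_le_sum_mul_sum_of_sq_le_mul _ (fun y _ => hp y)
      (fun y _ => mul_nonneg (hp y) (sq_nonneg _)) (fun y _ => le_of_eq (by ring))
  rw [e2, e3]
  have e6 : 0 ≤ ∑ y ∈ Finset.univ.erase x, p y * (h x - h y) ^ 2 :=
    Finset.sum_nonneg fun y _ => mul_nonneg (hp y) (sq_nonneg _)
  nlinarith

namespace LazyReversible

variable {M : Matrix V V ℝ} {π : V → ℝ} (hM : LazyReversible M π)
include hM

lemma pow_nonneg (n : ℕ) : ∀ x y, 0 ≤ (M ^ n) x y := by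
  induction n with
  | zero => intro x y; simp only [pow_zero, Matrix.one_apply]; split_ifs <;> norm_num
  | succ n ih =>
    intro x y
    rw [pow_succ, Matrix.mul_apply]
    exact Finset.sum_nonneg fun z _ => mul_nonneg (ih x z) (hM.nonneg z y)

lemma pow_row_sum (n : ℕ) : ∀ x, ∑ y, (M ^ n) x y = 1 := by
  induction n with
  | zero => intro x; simp [Matrix.one_apply]
  | succ n ih =>
    intro x
    simp only [pow_succ, Matrix.mul_apply]
    rw [Finset.sum_comm]
    simp only [← Finset.mul_sum, hM.row_sum, mul_one, ih]

lemma pow_rev (n : ℕ) : ∀ x y, π x * (M ^ n) x y = π y * (M ^ n) y x := by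
  induction n with
  | zero => intro x y; simp only [pow_zero, Matrix.one_apply, eq_comm]; split_ifs <;> simp_all
  | succ n ih =>
    intro x y
    rw [pow_succ]
    nth_rewrite 2 [← pow_succ]
    rw [pow_succ', Matrix.mul_apply, Matrix.mul_apply, Finset.mul_sum, Finset.mul_sum]
    refine Finset.sum_congr rfl fun z _ => ?_
    rw [← mul_assoc, ih x z, mul_right_comm, hM.rev z y]; ring

lemma pow_add_self_diag (m : ℕ) (x : V) :
    (M ^ (m + m)) x x = π x * ∑ y, (M ^ m) x y ^ 2 / π y := by
  rw [pow_add, Matrix.mul_apply, Finset.mul_sum]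
  refine Finset.sum_congr rfl fun y _ => ?_
  have := hM.pow_rev m x y
  have hy := (hM.pos y).ne'
  field_simp
  linear_combination -((M ^ m) x y) * this

/-- Cauchy–Schwarz: `1 = (∑ M ^ m)² ≤ (∑ π) ∑ (M ^ m)² / π`. -/
lemma le_pow_add_self_diag (m : ℕ) (x : V) : π x ≤ (M ^ (m + m)) x x := by
  rw [hM.pow_add_self_diag]
  have h := Finset.sum_sq_le_sum_mul_sum_of_sq_le_mul Finset.univ
    (r := fun y => (M ^ m) x y) (f := π) (g := fun y => (M ^ m) x y ^ 2 / π y)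
    (fun y _ => (hM.pos y).le) (fun y _ => div_nonneg (sq_nonneg _) (hM.pos y).le)
    (fun y _ => le_of_eq (by have := (hM.pos y).ne'; field_simp))
  rw [hM.pow_row_sum, hM.total] at h
  nlinarith [hM.pos x]

/-- An odd time is an even time followed by one holding step, which costs `1 / 3`. -/
lemma le_pow_diag (n : ℕ) (x : V) : π x / 3 ≤ (M ^ n) x x := by
  rcases Nat.even_or_odd n with ⟨m, rfl⟩ | ⟨m, rfl⟩
  · linarith [hM.le_pow_add_self_diag m x, hM.pos x]
  · rw [pow_succ, Matrix.mul_apply, two_mul]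
    have h1 : (M ^ (m + m)) x x * M x x ≤ ∑ z, (M ^ (m + m)) x z * M z x :=
      Finset.single_le_sum (f := fun z => (M ^ (m + m)) x z * M z x)
        (fun z _ => mul_nonneg (hM.pow_nonneg _ x z) (hM.nonneg z x)) (Finset.mem_univ x)
    have := hM.le_pow_add_self_diag m x
    nlinarith [hM.hold x, hM.pos x]

/-- By reversibility the entry is `π z` times an inner product of two densities, so `2ab ≤ a² + b²`
reduces it to the diagonal. -/
lemma pow_add_self_le {C : ℝ} {m : ℕ} (h : ∀ z, (M ^ (m + m)) z z ≤ C * π z) (x z : V) :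
    (M ^ (m + m)) x z ≤ C * π z := by
  have hx := hM.pos x
  have hz := hM.pos z
  have e : (M ^ (m + m)) x z = π z * ∑ y, (M ^ m) x y * (M ^ m) z y / π y := by
    rw [pow_add, Matrix.mul_apply, Finset.mul_sum]
    refine Finset.sum_congr rfl fun y _ => ?_
    have := hM.pow_rev m z y
    have hy := (hM.pos y).ne'
    field_simp
    linear_combination -((M ^ m) x y) * this
  have hb : ∀ u, ∑ y, (M ^ m) u y ^ 2 / π y ≤ C := fun u => by
    have := h u
    rw [hM.pow_add_self_diag, mul_comm] at this
    exact le_of_mul_le_mul_right this (hM.pos u)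
  have key : ∑ y, (M ^ m) x y * (M ^ m) z y / π y
      ≤ ∑ y, ((M ^ m) x y ^ 2 / π y + (M ^ m) z y ^ 2 / π y) / 2 := by
    refine Finset.sum_le_sum fun y _ => ?_
    rw [← add_div, div_div, mul_comm (π y), ← div_div]
    refine div_le_div_of_nonneg_right ?_ (hM.pos y).le
    nlinarith [sq_nonneg ((M ^ m) x y - (M ^ m) z y)]
  rw [← Finset.sum_div, Finset.sum_add_distrib] at key
  rw [e]
  nlinarith [hb x, hb z]

lemma pow_le_of_le {C : ℝ} {m n : ℕ} (hmn : m ≤ n) (h : ∀ x z, (M ^ m) x z ≤ C * π z) (x z : V) :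
    (M ^ n) x z ≤ C * π z := by
  obtain ⟨k, rfl⟩ := Nat.exists_eq_add_of_le' hmn
  rw [pow_add, Matrix.mul_apply]
  calc ∑ y, (M ^ k) x y * (M ^ m) y z ≤ ∑ y, (M ^ k) x y * (C * π z) :=
        Finset.sum_le_sum fun y _ => mul_le_mul_of_nonneg_left (h y z) (hM.pow_nonneg k x y)
    _ = C * π z := by rw [← Finset.sum_mul, hM.pow_row_sum, one_mul]

/-- By stationarity the right side is the `π`-average of the variances of `h` under the rows of `M`,
each bounded below through the holding probability. -/
lemma energy_le (h : V → ℝ) :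
    1 / 3 * energy M π h ≤ ∑ x, π x * h x ^ 2 - ∑ x, π x * (∑ y, M x y * h y) ^ 2 := by
  have e : ∑ x, π x * h x ^ 2 = ∑ x, π x * ∑ y, M x y * h y ^ 2 := by
    simp only [Finset.mul_sum]
    rw [Finset.sum_comm]
    refine Finset.sum_congr rfl fun y _ => ?_
    simp only [← mul_assoc, hM.rev _ y]
    rw [← Finset.sum_mul, ← Finset.mul_sum, hM.row_sum, mul_one]
  rw [e, ← Finset.sum_sub_distrib, energy, Finset.mul_sum]
  refine Finset.sum_le_sum fun x _ => ?_
  have := mul_le_mul_of_nonneg_left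
    (sum_mul_sq_sub_sq_ge (h := h) (hM.nonneg x) (hM.row_sum x) x (hM.hold x)) (hM.pos x).le
  simp only [mul_assoc, ← Finset.mul_sum]
  linarith

omit [DecidableEq V] in
lemma energy_max_le (h : V → ℝ) (l : ℝ) :
    energy M π (fun x => max (h x - l) 0) ≤ energy M π h := by
  refine Finset.sum_le_sum fun x _ => Finset.sum_le_sum fun y _ => ?_
  refine mul_le_mul_of_nonneg_left (sq_le_sq.2 ?_) (mul_nonneg (hM.pos x).le (hM.nonneg x y))
  refine (abs_max_sub_max_le_abs _ _ _).trans (le_of_eq ?_)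
  congr 1; ring

/-- Faber–Krahn inequality for functions with small support. -/
lemma faberKrahn {k : ℕ} {B : ℝ} (hB : 0 ≤ B) (hpath : HasPaths M π k B) (g : V → ℝ)
    (hg : (Finset.univ.filter fun x => g x ≠ 0).card ≤ k) :
    ∑ x, π x * g x ^ 2 ≤ 2 * B * (k : ℝ) ^ 2 * energy M π g := by
  obtain ⟨γ, h0, hinj, hcond, hcong⟩ := hpath
  set e : V → ℝ := fun u => ∑ v, π u * M u v * (g u - g v) ^ 2 with he
  have hterm : ∀ u v, 0 ≤ π u * M u v * (g u - g v) ^ 2 := fun u v =>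
    mul_nonneg (mul_nonneg (hM.pos u).le (hM.nonneg u v)) (sq_nonneg _)
  have he0 : ∀ u, 0 ≤ e u := fun u => Finset.sum_nonneg fun v _ => hterm u v
  have hpt : ∀ x, π x * g x ^ 2 ≤ ∑ j ∈ Finset.range k, (k * B) * e (γ x j) := by
    intro x
    -- The path visits `k + 1` distinct vertices and `g` is nonzero at no more than `k`, so the path
    -- meets a zero of `g`.
    obtain ⟨j, hj, hgj⟩ : ∃ j ≤ k, g (γ x j) = 0 := by
      by_contra! hne
      have hsub : (Finset.range (k + 1)).image (γ x) ⊆ Finset.univ.filter fun x => g x ≠ 0 := by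
        intro u hu
        obtain ⟨j, hj, rfl⟩ := Finset.mem_image.1 hu
        simpa using hne j (Nat.lt_succ_iff.1 (Finset.mem_range.1 hj))
      have hc := Finset.card_le_card hsub
      rw [Finset.card_image_of_injOn, Finset.card_range] at hc
      · omega
      · exact (hinj x).mono fun j hj => by simpa [Nat.lt_succ_iff] using hj
    have hs : g x = ∑ i ∈ Finset.range j, (g (γ x i) - g (γ x (i + 1))) := by
      rw [Finset.sum_range_sub' (fun i => g (γ x i)), h0, hgj, sub_zero]
    have hsq : g x ^ 2 ≤ k * ∑ i ∈ Finset.range k, (g (γ x i) - g (γ x (i + 1))) ^ 2 := by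
      rw [hs]
      refine sq_sum_le_card_mul_sum_sq.trans ?_
      rw [Finset.card_range]
      refine mul_le_mul (by exact_mod_cast hj) ?_ (Finset.sum_nonneg fun _ _ => sq_nonneg _)
        (Nat.cast_nonneg _)
      exact Finset.sum_le_sum_of_subset_of_nonneg
        (fun i hi => Finset.mem_range.2 ((Finset.mem_range.1 hi).trans_le hj))
        (fun _ _ _ => sq_nonneg _)
    refine (mul_le_mul_of_nonneg_left hsq (hM.pos x).le).trans ?_
    rw [mul_left_comm, Finset.mul_sum, Finset.mul_sum]
    refine Finset.sum_le_sum fun i hi => ?_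
    rw [mul_assoc]
    refine mul_le_mul_of_nonneg_left ?_ (Nat.cast_nonneg k)
    refine (mul_le_mul_of_nonneg_right (hcond x i (Finset.mem_range.1 hi)) (sq_nonneg _)).trans ?_
    rw [mul_assoc]
    exact mul_le_mul_of_nonneg_left (Finset.single_le_sum
      (f := fun v => π (γ x i) * M (γ x i) v * (g (γ x i) - g v) ^ 2)
      (fun v _ => hterm _ v) (Finset.mem_univ _)) hB
  have hlevel : ∀ j < k, ∑ x, e (γ x j) ≤ 2 * energy M π g := by
    intro j hj
    rw [← Finset.sum_fiberwise' Finset.univ (fun x => γ x j) e, energy, Finset.mul_sum]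
    refine Finset.sum_le_sum fun u _ => ?_
    rw [Finset.sum_const, nsmul_eq_mul]
    exact mul_le_mul_of_nonneg_right (by exact_mod_cast hcong j hj u) (he0 u)
  calc ∑ x, π x * g x ^ 2 ≤ ∑ x, ∑ j ∈ Finset.range k, (k * B) * e (γ x j) :=
        Finset.sum_le_sum fun x _ => hpt x
    _ = ∑ j ∈ Finset.range k, (k * B) * ∑ x, e (γ x j) := by
        rw [Finset.sum_comm]; simp only [Finset.mul_sum]
    _ ≤ ∑ j ∈ Finset.range k, (k * B) * (2 * energy M π g) :=
        Finset.sum_le_sum fun j hj => mul_le_mul_of_nonneg_left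
          (hlevel j (Finset.mem_range.1 hj)) (mul_nonneg (Nat.cast_nonneg k) hB)
    _ = 2 * B * (k : ℝ) ^ 2 * energy M π g := by
        rw [Finset.sum_const, Finset.card_range, nsmul_eq_mul]; ring

end LazyReversible

end Abstract

/-! ### From a Nash inequality to a heat kernel bound. -/

/-- Discrete form of `φ' ≤ -(κ / s) φ ^ (1 + p)`: as long as `φ ≥ Φ`, the quantity `φ ^ (-p)` grows
by at least `p κ / s` per step, so it reaches 1. -/
lemma le_max_of_rpow_decay {φ : ℕ → ℝ} {p κ s Φ : ℝ} (hp : 0 < p) (hκ : 0 < κ) (hs : 0 < s)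
    (hpos : ∀ n, 0 < φ n) (hanti : Antitone φ)
    (hstep : ∀ n, Φ ≤ φ n → φ n ^ (1 + p) * κ ≤ s * (φ n - φ (n + 1))) {n : ℕ}
    (hn : s ≤ p * κ * n) : φ n ≤ max Φ 1 := by
  by_contra! hlt
  obtain ⟨h1, h2⟩ := max_lt_iff.1 hlt
  have key : ∀ i ≤ n, p * κ * i / s ≤ φ i ^ (-p) := by
    intro i
    induction i with
    | zero => intro _; simpa using (Real.rpow_pos_of_pos (hpos 0) _).le
    | succ i ih =>
      intro hi
      have hi' := ih (Nat.le_of_succ_le hi)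
      have hst := hstep i (h1.le.trans (hanti (Nat.le_of_succ_le hi)))
      set a := φ i with ha
      have ha0 : 0 < a := hpos i
      rw [Real.rpow_add ha0, Real.rpow_one] at hst
      have hap : 0 < a ^ p := Real.rpow_pos_of_pos ha0 p
      set u := κ * a ^ p / s with hu
      have hle : φ (i + 1) ≤ a * Real.exp (-u) := by
        have h3 : a * u ≤ a - φ (i + 1) := by
          rw [hu, mul_div_assoc', div_le_iff₀ hs]; nlinarith
        nlinarith [Real.add_one_le_exp (-u)]
      have h4 : (a * Real.exp (-u)) ^ (-p) ≤ φ (i + 1) ^ (-p) :=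
        Real.rpow_le_rpow_of_nonpos (hpos _) hle (by linarith)
      have h5 : (a * Real.exp (-u)) ^ (-p) = a ^ (-p) * Real.exp (p * u) := by
        rw [Real.mul_rpow ha0.le (Real.exp_pos _).le, ← Real.exp_mul]; congr 2; ring
      have h6 : a ^ (-p) * (p * u) = p * κ / s := by
        rw [hu, Real.rpow_neg ha0.le]; field_simp
      have h7 : a ^ (-p) * (p * u + 1) ≤ a ^ (-p) * Real.exp (p * u) :=
        mul_le_mul_of_nonneg_left (Real.add_one_le_exp _) (Real.rpow_pos_of_pos ha0 _).le
      push_cast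
      have h8 : p * κ * ((i : ℝ) + 1) / s = p * κ * i / s + p * κ / s := by ring
      rw [h8]
      nlinarith
  have h3 := key n le_rfl
  have h4 : φ n ^ (-p) < 1 := Real.rpow_lt_one_of_one_lt_of_neg h2 (by linarith)
  have h5 : 1 ≤ p * κ * n / s := by rwa [le_div_iff₀ hs, one_mul]
  linarith

namespace LazyReversible

variable {V : Type*} [Fintype V] [DecidableEq V]
variable {M : Matrix V V ℝ} {π : V → ℝ}

/-- A Nash inequality at small scales, from the Faber–Krahn inequality for level sets. -/
lemma nash_step (hM : LazyReversible M π) {N : ℕ} {D B c : ℝ} (hD : 0 < D) (hB : 0 < B)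
    (hc : 0 < c) (hpath : ∀ k : ℕ, 4 * k ≤ N → HasPaths M π k B)
    (hvol : ∀ S : Finset V, c * (S.card : ℝ) ^ D ≤ (N : ℝ) ^ D * ∑ x ∈ S, π x)
    {h : V → ℝ} (h0 : ∀ x, 0 ≤ h x) (h1 : ∑ x, π x * h x = 1)
    (hφ : 4 ^ (D + 1) / c ≤ ∑ x, π x * h x ^ 2) :
    (∑ x, π x * h x ^ 2) ^ (1 + 2 / D) * ((c / 4) ^ (2 / D) / (12 * B))
      ≤ (N : ℝ) ^ 2 * (∑ x, π x * h x ^ 2 - ∑ x, π x * (∑ y, M x y * h y) ^ 2) := by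
  set φ := ∑ x, π x * h x ^ 2 with hφdef
  set d := φ - ∑ x, π x * (∑ y, M x y * h y) ^ 2 with hd
  have hφ0 : 0 < φ := lt_of_lt_of_le (by positivity) hφ
  -- At level `φ / 4`, Markov's inequality bounds the mass of the support by `4 / φ`, while `g² ≥ h²
  -- - (φ / 2) h` keeps half of `φ`.
  set g : V → ℝ := fun x => max (h x - φ / 4) 0 with hg
  set S := Finset.univ.filter fun x => g x ≠ 0 with hS
  have hmass : φ / 4 * ∑ x ∈ S, π x ≤ 1 := by
    rw [← h1, Finset.mul_sum]
    refine (Finset.sum_le_sum fun x hx => ?_).trans (Finset.sum_le_sum_of_subset_of_nonneg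
      (Finset.subset_univ S) fun x _ _ => mul_nonneg (hM.pos x).le (h0 x))
    rw [mul_comm]
    refine mul_le_mul_of_nonneg_left ?_ (hM.pos x).le
    by_contra! hlt
    exact (Finset.mem_filter.1 hx).2 (max_eq_right (by linarith))
  have hN0 : (0 : ℝ) ≤ N := Nat.cast_nonneg N
  have hr0 : 0 < 4 / (c * φ) := by positivity
  have hkD : (S.card : ℝ) ^ D ≤ (N : ℝ) ^ D * (4 / (c * φ)) := by
    have h2 := hvol S
    have h3 : ∑ x ∈ S, π x ≤ 4 / φ := by rw [le_div_iff₀ hφ0]; linarith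
    have h4 : c * (S.card : ℝ) ^ D ≤ (N : ℝ) ^ D * (4 / φ) :=
      h2.trans (mul_le_mul_of_nonneg_left h3 (Real.rpow_nonneg hN0 _))
    calc (S.card : ℝ) ^ D = c * (S.card : ℝ) ^ D / c := by field_simp
      _ ≤ (N : ℝ) ^ D * (4 / φ) / c := div_le_div_of_nonneg_right h4 hc.le
      _ = _ := by field_simp
  have hk : (S.card : ℝ) ≤ N * (4 / (c * φ)) ^ (1 / D) := by
    have h2 := Real.rpow_le_rpow (by positivity) hkD (z := 1 / D) (by positivity)
    rwa [Real.mul_rpow (by positivity) hr0.le, ← Real.rpow_mul (by positivity),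
      ← Real.rpow_mul hN0, mul_one_div_cancel hD.ne', Real.rpow_one, Real.rpow_one] at h2
  -- The threshold on `φ` is chosen exactly so that the support is small enough for paths of that
  -- length to be available.
  have hk4 : 4 * S.card ≤ N := by
    have h2 : 4 / (c * φ) ≤ (1 / 4) ^ D := by
      rw [div_le_iff₀ hc] at hφ
      rw [div_le_iff₀ (by positivity), Real.div_rpow (by norm_num) (by norm_num), Real.one_rpow,
        one_div, ← div_eq_inv_mul, le_div_iff₀ (by positivity)]
      rw [Real.rpow_add (by norm_num), Real.rpow_one] at hφ
      linarith
    have h3 := Real.rpow_le_rpow hr0.le h2 (z := 1 / D) (by positivity)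
    rw [← Real.rpow_mul (by norm_num), mul_one_div_cancel hD.ne', Real.rpow_one] at h3
    have h4 : (S.card : ℝ) ≤ N * (1 / 4) := hk.trans (mul_le_mul_of_nonneg_left h3 hN0)
    have h5 : (4 : ℝ) * S.card ≤ N := by linarith
    exact_mod_cast h5
  have hk2 : (S.card : ℝ) ^ 2 ≤ (N : ℝ) ^ 2 * (4 / (c * φ)) ^ (2 / D) := by
    have h2 := pow_le_pow_left₀ (Nat.cast_nonneg _) hk 2
    rwa [mul_pow, ← Real.rpow_mul_natCast hr0.le, Nat.cast_ofNat, one_div_mul_eq_div] at h2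
  have hen : energy M π g ≤ 3 * d := by
    have := hM.energy_max_le h (φ / 4)
    have h3 := hM.energy_le h
    linarith
  have hen0 : 0 ≤ energy M π g := Finset.sum_nonneg fun x _ => Finset.sum_nonneg fun y _ =>
    mul_nonneg (mul_nonneg (hM.pos x).le (hM.nonneg x y)) (sq_nonneg _)
  have hfk := hM.faberKrahn hB.le (hpath S.card hk4) g le_rfl
  have hg2 : φ / 2 ≤ ∑ x, π x * g x ^ 2 := by
    have h2 : ∑ x, (π x * h x ^ 2 - φ / 2 * (π x * h x)) = φ / 2 := by
      rw [Finset.sum_sub_distrib, ← Finset.mul_sum, h1]; ring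
    rw [← h2]
    refine Finset.sum_le_sum fun x _ => ?_
    have h3 : h x ^ 2 - φ / 2 * h x ≤ g x ^ 2 := by
      rcases le_total (h x) (φ / 4) with hx | hx
      · nlinarith [sq_nonneg (g x), h0 x]
      · rw [hg]; simp only [max_eq_left (sub_nonneg.2 hx)]; nlinarith [sq_nonneg φ]
    nlinarith [mul_le_mul_of_nonneg_left h3 (hM.pos x).le]
  have hfin : φ / 2 ≤ 6 * B * ((N : ℝ) ^ 2 * (4 / (c * φ)) ^ (2 / D)) * d := by
    have hd0 : 0 ≤ d := by linarith
    calc φ / 2 ≤ 2 * B * (S.card : ℝ) ^ 2 * energy M π g := hg2.trans hfk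
      _ ≤ 2 * B * (S.card : ℝ) ^ 2 * (3 * d) := by gcongr
      _ ≤ 2 * B * ((N : ℝ) ^ 2 * (4 / (c * φ)) ^ (2 / D)) * (3 * d) := by gcongr
      _ = _ := by ring
  have hinv : (4 / (c * φ)) ^ (2 / D) = ((c / 4) ^ (2 / D))⁻¹ * (φ ^ (2 / D))⁻¹ := by
    rw [← mul_inv, ← Real.mul_rpow (by positivity) hφ0.le, ← Real.inv_rpow (by positivity)]
    congr 1; field_simp
  rw [hinv] at hfin
  have hu : 0 < (c / 4) ^ (2 / D) := by positivity
  have hv : 0 < φ ^ (2 / D) := by positivity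
  rw [Real.rpow_add hφ0, Real.rpow_one, mul_div_assoc', div_le_iff₀ (by positivity)]
  calc φ * φ ^ (2 / D) * (c / 4) ^ (2 / D)
      = φ / 2 * (2 * φ ^ (2 / D) * (c / 4) ^ (2 / D)) := by ring
    _ ≤ 6 * B * ((N : ℝ) ^ 2 * (((c / 4) ^ (2 / D))⁻¹ * (φ ^ (2 / D))⁻¹)) * d
          * (2 * φ ^ (2 / D) * (c / 4) ^ (2 / D)) :=
        mul_le_mul_of_nonneg_right hfin (by positivity)
    _ = _ := by field_simp; ring

/-- On-diagonal heat kernel bound at times of order `N ^ 2`. -/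
lemma pow_le_of_paths (hM : LazyReversible M π) {N : ℕ} (hN : 1 ≤ N) {D B c : ℝ} (hD : 0 < D)
    (hB : 0 < B) (hc : 0 < c) (hpath : ∀ k : ℕ, 4 * k ≤ N → HasPaths M π k B)
    (hvol : ∀ S : Finset V, c * (S.card : ℝ) ^ D ≤ (N : ℝ) ^ D * ∑ x ∈ S, π x) {n : ℕ}
    (hn : (N : ℝ) ^ 2 ≤ 2 / D * ((c / 4) ^ (2 / D) / (12 * B)) * n) (x z : V) :
    (M ^ (n + n)) x z ≤ max (4 ^ (D + 1) / c) 1 * π z := by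
  refine hM.pow_add_self_le (fun z => ?_) x z
  -- Densities of the rows from `z`. Reversibility lets `M` act on them, and `φ n` is the squared
  -- `L²(π)` norm, equal to `M ^ (2n) z z / π z`.
  set h : ℕ → V → ℝ := fun n x => (M ^ n) z x / π x with hh
  have hne : ∀ x, π x ≠ 0 := fun x => (hM.pos x).ne'
  have hsucc : ∀ n x, ∑ y, M x y * h n y = h (n + 1) x := by
    intro n x
    simp only [hh, pow_succ, Matrix.mul_apply, Finset.sum_div]
    refine Finset.sum_congr rfl fun y _ => ?_
    have := hM.rev x y
    have h1 := hne x
    have h2 := hne y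
    field_simp
    linear_combination (M ^ n) z y * this
  set φ : ℕ → ℝ := fun n => ∑ x, π x * h n x ^ 2 with hφ
  have hdiag : ∀ n, (M ^ (n + n)) z z = φ n * π z := by
    intro n
    rw [hM.pow_add_self_diag, mul_comm]
    congr 1
    refine Finset.sum_congr rfl fun x _ => ?_
    have h1 := hne x
    simp only [hh]; field_simp
  have hpos : ∀ n, 0 < φ n := by
    intro n
    have := hM.le_pow_add_self_diag n z
    rw [hdiag] at this
    exact (mul_pos_iff_of_pos_right (hM.pos z)).1 ((hM.pos z).trans_le this)
  have hdrop : ∀ n, φ n - φ (n + 1) = ∑ x, π x * h n x ^ 2 - ∑ x, π x * (∑ y, M x y * h n y) ^ 2 := by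
    intro n; simp only [hsucc, hφ]
  have hanti : Antitone φ := by
    refine antitone_nat_of_succ_le fun n => ?_
    have h1 := hM.energy_le (h n)
    rw [← hdrop] at h1
    have h2 : 0 ≤ energy M π (h n) := Finset.sum_nonneg fun x _ => Finset.sum_nonneg fun y _ =>
      mul_nonneg (mul_nonneg (hM.pos x).le (hM.nonneg x y)) (sq_nonneg _)
    linarith
  rw [hdiag]
  refine mul_le_mul_of_nonneg_right ?_ (hM.pos z).le
  refine le_max_of_rpow_decay (p := 2 / D) (κ := (c / 4) ^ (2 / D) / (12 * B)) (by positivity)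
    (by positivity) (s := (N : ℝ) ^ 2) (by positivity) hpos hanti (fun m hm => ?_) hn
  rw [hdrop]
  refine hM.nash_step hD hB hc hpath hvol
    (fun x => div_nonneg (hM.pow_nonneg m z x) (hM.pos x).le) ?_ hm
  rw [← hM.pow_row_sum m z]
  exact Finset.sum_congr rfl fun x _ => mul_div_cancel₀ _ (hne x)

end LazyReversible

/-! ### Products of kernels, contraction of column ratios and merging time. -/

section Inhomogeneous

variable {V : Type*} [Fintype V] [DecidableEq V]

lemma iterKernel_add (K : ℕ → Matrix V V ℝ) (m n : ℕ) :
    iterKernel K (m + n) = iterKernel K m * iterKernel (fun i => K (m + i)) n := by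
  induction n with
  | zero => simp [iterKernel]
  | succ n ih => rw [← add_assoc, iterKernel, ih, iterKernel, mul_assoc, add_assoc]

lemma iterKernel_succ (K : ℕ → Matrix V V ℝ) (n : ℕ) :
    iterKernel K (n + 1) = K 1 * iterKernel (fun i => K (1 + i)) n := by
  rw [add_comm, iterKernel_add]; simp [iterKernel]

lemma iterKernel_const (M : Matrix V V ℝ) (n : ℕ) : iterKernel (fun _ => M) n = M ^ n := by
  induction n with
  | zero => simp [iterKernel]
  | succ n ih => rw [iterKernel, ih, pow_succ]

-- Doeblin contraction: `P y ≥ P x / R` gives `P x - P y ≤ (1 - 1 / R) P x`. Subtracting the minimum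
-- of `f` leaves a nonnegative function of size at most `δ` times that minimum.
omit [DecidableEq V] in
lemma mul_apply_ratio_le {P : Matrix V V ℝ} (hP0 : ∀ x y, 0 ≤ P x y) (hP1 : ∀ x, ∑ y, P x y = 1)
    {R : ℝ} (hR : 0 < R) (hR1 : ∀ x y z, P x z ≤ R * P y z) {f : V → ℝ} {δ : ℝ}
    (hf : ∀ x y, f x ≤ (1 + δ) * f y) (hf0 : ∀ x, 0 ≤ f x) (hδ : 0 ≤ δ) (hR2 : 1 ≤ R) (x y : V) :
    ∑ u, P x u * f u ≤ (1 + (1 - 1 / R) * δ) * ∑ u, P y u * f u := by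
  obtain ⟨v, -, hv⟩ := Finset.exists_min_image Finset.univ f ⟨x, Finset.mem_univ x⟩
  set μ := f v with hμ
  have hμ0 : 0 ≤ μ := hf0 v
  have hmin : ∀ u, μ ≤ f u := fun u => hv u (Finset.mem_univ u)
  have hdiff : ∑ u, P x u * f u - ∑ u, P y u * f u = ∑ u, (P x u - P y u) * (f u - μ) := by
    simp only [sub_mul, mul_sub, Finset.sum_sub_distrib, ← Finset.sum_mul, hP1]; ring
  have hq : 0 ≤ 1 - 1 / R := by rw [sub_nonneg, div_le_one hR]; exact hR2
  have hbd : ∑ u, (P x u - P y u) * (f u - μ) ≤ ∑ u, P x u * ((1 - 1 / R) * (δ * μ)) := by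
    refine Finset.sum_le_sum fun u _ => ?_
    have h1 : P x u / R ≤ P y u := by rw [div_le_iff₀ hR]; linarith [hR1 x y u]
    calc (P x u - P y u) * (f u - μ) ≤ ((1 - 1 / R) * P x u) * (f u - μ) := by
          refine mul_le_mul_of_nonneg_right ?_ (sub_nonneg.2 (hmin u))
          have : (1 - 1 / R) * P x u = P x u - P x u / R := by ring
          linarith
      _ ≤ ((1 - 1 / R) * P x u) * (δ * μ) := by
          refine mul_le_mul_of_nonneg_left ?_ (mul_nonneg hq (hP0 x u))
          linarith [hf u v]
      _ = _ := by ring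
  rw [← Finset.sum_mul, hP1, one_mul] at hbd
  have hlow : μ ≤ ∑ u, P y u * f u := by
    calc μ = ∑ u, P y u * μ := by rw [← Finset.sum_mul, hP1, one_mul]
      _ ≤ _ := Finset.sum_le_sum fun u _ => mul_le_mul_of_nonneg_left (hmin u) (hP0 y u)
  have := mul_le_mul_of_nonneg_left hlow (mul_nonneg hq hδ)
  nlinarith

lemma iterKernel_nonneg {K : ℕ → Matrix V V ℝ} (h : ∀ i, 1 ≤ i → ∀ x y, 0 ≤ K i x y) (n : ℕ) :
    ∀ x y, 0 ≤ iterKernel K n x y := by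
  induction n with
  | zero => intro x y; simp only [iterKernel, Matrix.one_apply]; split_ifs <;> norm_num
  | succ n ih =>
    intro x y
    rw [iterKernel, Matrix.mul_apply]
    exact Finset.sum_nonneg fun z _ => mul_nonneg (ih x z) (h _ (by omega) z y)

lemma iterKernel_row_sum {K : ℕ → Matrix V V ℝ} (h : ∀ i, 1 ≤ i → ∀ x, ∑ y, K i x y = 1) (n : ℕ) :
    ∀ x, ∑ y, iterKernel K n x y = 1 := by
  induction n with
  | zero => intro x; simp [iterKernel, Matrix.one_apply]
  | succ n ih =>
    intro x
    simp only [iterKernel, Matrix.mul_apply]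
    rw [Finset.sum_comm]
    simp only [← Finset.mul_sum, h _ (Nat.le_add_left 1 n), mul_one, ih]

/-- If all products of `T` kernels have column ratios at most `R`, then the column ratios of the
products of `(q + 1) T` kernels tend to one geometrically in `q`. -/
lemma iterKernel_block_ratio {𝒬 : Set (Matrix V V ℝ)} (h0 : ∀ P ∈ 𝒬, ∀ x y, 0 ≤ P x y)
    (h1 : ∀ P ∈ 𝒬, ∀ x, ∑ y, P x y = 1) {T : ℕ} {R : ℝ} (hR : 1 ≤ R)
    (hT : ∀ K : ℕ → Matrix V V ℝ, (∀ i, 1 ≤ i → K i ∈ 𝒬) → ∀ x y z,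
      0 < iterKernel K T x z ∧ iterKernel K T x z ≤ R * iterKernel K T y z) (q : ℕ) :
    ∀ K : ℕ → Matrix V V ℝ, (∀ i, 1 ≤ i → K i ∈ 𝒬) → ∀ x y z,
      0 < iterKernel K ((q + 1) * T) x z ∧ iterKernel K ((q + 1) * T) x z
        ≤ (1 + (1 - 1 / R) ^ q * (R - 1)) * iterKernel K ((q + 1) * T) y z := by
  have hR0 : 0 < R := one_pos.trans_le hR
  have hq : 0 ≤ 1 - 1 / R := by rw [sub_nonneg, div_le_one hR0]; exact hR
  induction q with
  | zero => simpa using hT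
  | succ q ih =>
    intro K hK x y z
    have hK' : ∀ i, 1 ≤ i → K (T + i) ∈ 𝒬 := fun i hi => hK _ (by omega)
    have e : (q + 1 + 1) * T = T + (q + 1) * T := by ring
    rw [e, iterKernel_add]
    simp only [Matrix.mul_apply]
    have hf := ih _ hK'
    refine ⟨Finset.sum_pos (fun u _ => mul_pos (hT K hK x x u).1 (hf u u z).1)
      ⟨x, Finset.mem_univ x⟩, ?_⟩
    rw [pow_succ', mul_assoc]
    exact mul_apply_ratio_le (iterKernel_nonneg (fun i hi => h0 _ (hK i hi)) T)
      (iterKernel_row_sum (fun i hi => h1 _ (hK i hi)) T) hR0 (fun x y z => (hT K hK x y z).2)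
      (fun x y => (hf x y z).2) (fun x => (hf x x z).1.le)
      (mul_nonneg (pow_nonneg hq q) (by linarith)) hR x y

lemma mergingTime_le_of_ratio {K : ℕ → Matrix V V ℝ} {n : ℕ} {δ η : ℝ} (hδ : 0 ≤ δ)
    (hη : δ < η) (h : ∀ x y z, 0 < iterKernel K n x z ∧
      iterKernel K n x z ≤ (1 + δ) * iterKernel K n y z) : mergingTime K η ≤ n := by
  have hlt : ENNReal.ofReal δ < ENNReal.ofReal η :=
    (ENNReal.ofReal_lt_ofReal_iff (hδ.trans_lt hη)).2 hη
  refine iInf₂_le_of_le n (lt_of_le_of_lt ?_ hlt) le_rfl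
  refine iSup_le fun x => iSup_le fun y => iSup_le fun z => ?_
  obtain ⟨hx, hxy⟩ := h x y z
  obtain ⟨hy, hyx⟩ := h y x z
  rw [relDev, if_neg hy.ne']
  refine ENNReal.ofReal_le_ofReal (abs_le.2 ⟨?_, ?_⟩)
  · have : (1 - δ) ≤ iterKernel K n x z / iterKernel K n y z := by
      rw [le_div_iff₀ hy]
      -- With `x` and `y` exchanged the ratio is at least `1 / (1 + δ) ≥ 1 - δ`; for `δ ≥ 1`
      -- positivity is enough.
      rcases le_total δ 1 with h1 | h1
      · nlinarith [mul_le_mul_of_nonneg_left hyx (sub_nonneg.2 h1), sq_nonneg δ]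
      · nlinarith
    linarith
  · have : iterKernel K n x z / iterKernel K n y z ≤ 1 + δ := (div_le_iff₀ hy).2 hxy
    linarith

/-- Merging time bound from a uniform ratio bound for products of `T` kernels. -/
lemma mergingTime_le_of_block {𝒬 : Set (Matrix V V ℝ)} (h0 : ∀ P ∈ 𝒬, ∀ x y, 0 ≤ P x y)
    (h1 : ∀ P ∈ 𝒬, ∀ x, ∑ y, P x y = 1) {T : ℕ} {R : ℝ} (hR : 1 ≤ R)
    (hT : ∀ K : ℕ → Matrix V V ℝ, (∀ i, 1 ≤ i → K i ∈ 𝒬) → ∀ x y z,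
      0 < iterKernel K T x z ∧ iterKernel K T x z ≤ R * iterKernel K T y z)
    {K : ℕ → Matrix V V ℝ} (hK : ∀ i, 1 ≤ i → K i ∈ 𝒬) {η : ℝ} (hη : 0 < η) :
    (mergingTime K η : ℝ≥0∞) ≤
      ENNReal.ofReal ((2 + R + R * Real.log R) * (T * (1 + Real.posLog (1 / η)))) := by
  have hR0 : 0 < R := one_pos.trans_le hR
  have hL0 : 0 ≤ Real.posLog (1 / η) := Real.posLog_nonneg
  have hlogR : 0 ≤ Real.log R := Real.log_nonneg hR
  -- Chosen so that `R (1 - 1 / R) ^ q ≤ R exp (-q / R) ≤ η`; having `R - 1` in place of `R` makes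
  -- the inequality strict.
  set q := ⌈R * (Real.log R + Real.posLog (1 / η))⌉₊ with hq
  have hqle : R * (Real.log R + Real.posLog (1 / η)) ≤ q := Nat.le_ceil _
  have hqlt : (q : ℝ) < R * (Real.log R + Real.posLog (1 / η)) + 1 :=
    Nat.ceil_lt_add_one (by positivity)
  have hq0 : 0 ≤ 1 - 1 / R := by rw [sub_nonneg, div_le_one hR0]; exact hR
  have hsmall : (1 - 1 / R) ^ q * (R - 1) < η := by
    have e1 : (1 - 1 / R) ^ q ≤ Real.exp (-(q / R)) := by
      have := pow_le_pow_left₀ hq0 (Real.one_sub_le_exp_neg (1 / R)) q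
      rwa [← Real.exp_nat_mul, mul_neg, mul_one_div] at this
    have e2 : Real.exp (-(q / R)) * R ≤ η := by
      rw [← Real.exp_log hR0, ← Real.exp_add, Real.exp_log hR0, ← Real.le_log_iff_exp_le hη]
      have e3 : Real.log R + Real.posLog (1 / η) ≤ q / R := by
        rw [le_div_iff₀ hR0]; linarith
      have e4 : -Real.log η ≤ Real.posLog (1 / η) := by
        rw [← Real.log_inv, ← one_div]; exact le_max_right _ _
      linarith
    have e5 := Real.exp_pos (-(q / R))
    nlinarith [mul_le_mul_of_nonneg_right e1 (sub_nonneg.2 hR)]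
  have hm := mergingTime_le_of_ratio (mul_nonneg (pow_nonneg hq0 q) (by linarith)) hsmall
    (iterKernel_block_ratio h0 h1 hR hT q K hK)
  calc (mergingTime K η : ℝ≥0∞) ≤ (((q + 1) * T : ℕ) : ℕ∞) := by exact_mod_cast hm
    _ = ENNReal.ofReal (((q + 1) * T : ℕ) : ℝ) := by rw [ENNReal.ofReal_natCast]; rfl
    _ ≤ _ := by
      refine ENNReal.ofReal_le_ofReal ?_
      push_cast
      have e1 : ((q : ℝ) + 1) ≤ (2 + R + R * Real.log R) * (1 + Real.posLog (1 / η)) := by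
        nlinarith [mul_nonneg (mul_nonneg hR0.le hlogR) hL0, mul_nonneg hR0.le hL0]
      nlinarith [mul_le_mul_of_nonneg_right e1 (Nat.cast_nonneg (α := ℝ) T)]

/-- `P` is a Markov kernel that differs from `M` only in row `o`, where it keeps the sums over
`σ`-orbits and loses at most half of every entry. -/
structure IsMidPerturbation (M : Matrix V V ℝ) (o : V) (σ : Equiv.Perm V) (P : Matrix V V ℝ) :
    Prop where
  nonneg : ∀ x y, 0 ≤ P x y
  row_sum : ∀ x, ∑ y, P x y = 1
  off : ∀ x, x ≠ o → ∀ y, P x y = M x y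
  fold : ∀ z, P o z + P o (σ z) = M o z + M o (σ z)
  half : ∀ z, M o z ≤ 2 * P o z

/-! ### Mid-perturbations: folding and lower bounds. -/

section

variable {M : Matrix V V ℝ} {π : V → ℝ} {o : V} {σ : Equiv.Perm V} {K : ℕ → Matrix V V ℝ}

/-- The folded last step `g` is the same for `K` and `M`, and is `σ`-invariant. Its integral against
a row therefore sees only the orbit sums of that row, which agree by induction. -/
lemma iterKernel_fold (hσσ : ∀ x, σ (σ x) = x) (hMσ : ∀ x y, M (σ x) (σ y) = M x y)
    (hK : ∀ i, 1 ≤ i → IsMidPerturbation M o σ (K i)) (n : ℕ) : ∀ x z,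
    iterKernel K n x z + iterKernel K n x (σ z) = (M ^ n) x z + (M ^ n) x (σ z) := by
  induction n with
  | zero => intro x z; simp [iterKernel]
  | succ n ih =>
    intro x z
    set g : V → ℝ := fun u => M u z + M u (σ z) with hg
    have hgσ : ∀ u, g (σ u) = g u := fun u => by
      have h1 := hMσ u (σ z)
      rw [hσσ] at h1
      simp only [hg, h1, hMσ u z, add_comm]
    have hPg : ∀ u, K (n + 1) u z + K (n + 1) u (σ z) = g u := by
      intro u
      have h := hK (n + 1) (by omega)
      by_cases hu : u = o
      · rw [hu]; exact h.fold z
      · rw [h.off u hu, h.off u hu]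
    have hsym : ∀ a : V → ℝ, 2 * ∑ u, a u * g u = ∑ u, (a u + a (σ u)) * g u := by
      intro a
      have : ∑ u, a (σ u) * g u = ∑ u, a u * g u := by
        rw [← Equiv.sum_comp σ (fun u => a u * g u)]
        simp only [hgσ]
      simp only [add_mul, Finset.sum_add_distrib, this]; ring
    have h1 : ∑ u, iterKernel K n x u * g u = ∑ u, (M ^ n) x u * g u := by
      have e1 := hsym (fun u => iterKernel K n x u)
      have e2 := hsym (fun u => (M ^ n) x u)
      simp only [ih] at e1
      linarith
    rw [iterKernel, pow_succ]
    simp only [Matrix.mul_apply, ← Finset.sum_add_distrib, ← mul_add, hPg]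
    exact h1

lemma iterKernel_mid (hσσ : ∀ x, σ (σ x) = x) (hMσ : ∀ x y, M (σ x) (σ y) = M x y)
    (hσo : σ o = o) (hK : ∀ i, 1 ≤ i → IsMidPerturbation M o σ (K i)) (n : ℕ) (x : V) :
    iterKernel K n x o = (M ^ n) x o := by
  have := iterKernel_fold hσσ hMσ hK n x o
  rw [hσo] at this
  linarith

/-- Induct on the last step. If it leaves `o`, the mass at `o` is exactly that of `M ^ n` and only
this step loses a factor 2; elsewhere the step is unperturbed. The factor is thus paid once, not
once per visit. -/
lemma pow_le_two_mul_iterKernel (hM : LazyReversible M π) (hσσ : ∀ x, σ (σ x) = x)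
    (hMσ : ∀ x y, M (σ x) (σ y) = M x y) (hσo : σ o = o)
    (hK : ∀ i, 1 ≤ i → IsMidPerturbation M o σ (K i)) (n : ℕ) :
    ∀ z, (M ^ n) o z ≤ 2 * iterKernel K n o z := by
  induction n with
  | zero =>
    intro z
    simp only [pow_zero, iterKernel, Matrix.one_apply]
    split_ifs <;> norm_num
  | succ n ih =>
    intro z
    have h := hK (n + 1) (by omega)
    rw [pow_succ, iterKernel, Matrix.mul_apply, Matrix.mul_apply, Finset.mul_sum]
    refine Finset.sum_le_sum fun u _ => ?_
    by_cases hu : u = o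
    · rw [hu, iterKernel_mid hσσ hMσ hσo hK]
      nlinarith [mul_le_mul_of_nonneg_left (h.half z) (hM.pow_nonneg n o o)]
    · rw [h.off u hu]
      nlinarith [mul_le_mul_of_nonneg_right (ih u) (hM.nonneg u z)]

/-- A lower bound at `o` for all large times spreads to every starting point, at a speed governed
by a Lyapunov function `W`. -/
lemma iterKernel_ge_of_lyapunov (hM : LazyReversible M π) {W : V → ℝ} (hW0 : ∀ x, 0 ≤ W x)
    (hW : ∀ x, x ≠ o → ∑ y, M x y * W y ≤ W x - 1) {n₀ : ℕ} {q : ℝ} (hq : 0 ≤ q) (z : V)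
    (hmid : ∀ K : ℕ → Matrix V V ℝ, (∀ i, 1 ≤ i → IsMidPerturbation M o σ (K i)) → ∀ n, n₀ ≤ n →
      q ≤ iterKernel K n o z) (k : ℕ) :
    ∀ K : ℕ → Matrix V V ℝ, (∀ i, 1 ≤ i → IsMidPerturbation M o σ (K i)) → ∀ x,
      q * (k - W x) ≤ k * iterKernel K (n₀ + k) x z := by
  induction k with
  | zero => intro K _ x; simp only [Nat.cast_zero]; nlinarith [mul_nonneg hq (hW0 x)]
  | succ k ih =>
    intro K hK x
    have hnn := iterKernel_nonneg (fun i hi => (hK i hi).nonneg) (n₀ + (k + 1)) x z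
    by_cases hx : x = o
    · subst hx
      have h1 := hmid K hK (n₀ + (k + 1)) (by omega)
      have h2 := mul_le_mul_of_nonneg_left h1 (Nat.cast_nonneg (α := ℝ) (k + 1))
      nlinarith [mul_nonneg hq (hW0 x)]
    -- Away from `o` the first step follows `M`, and the unit drop of `W` turns `k` into `k + 1`.
    -- The result is Markov's inequality `P(τ > k) ≤ W x / k` for the hitting time `τ` of `o`,
    -- without hitting times.
    · have hK' : ∀ i, 1 ≤ i → IsMidPerturbation M o σ (K (1 + i)) := fun i hi => hK _ (by omega)
      have h1 : ∀ u, M x u * (q * (k - W u))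
          ≤ M x u * (k * iterKernel (fun i => K (1 + i)) (n₀ + k) u z) := fun u =>
        mul_le_mul_of_nonneg_left (ih _ hK' u) (hM.nonneg x u)
      have h2 := Finset.sum_le_sum fun u (_ : u ∈ Finset.univ) => h1 u
      have e1 : ∑ u, M x u * (q * (k - W u)) = q * (k - ∑ u, M x u * W u) := by
        have : ∀ u, M x u * (q * (k - W u)) = M x u * (q * k) - q * (M x u * W u) := fun u => by
          ring
        simp only [this, Finset.sum_sub_distrib, ← Finset.sum_mul, ← Finset.mul_sum, hM.row_sum]
        ring
      have e2 : ∑ u, M x u * (k * iterKernel (fun i => K (1 + i)) (n₀ + k) u z)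
          = k * iterKernel K (n₀ + (k + 1)) x z := by
        rw [← add_assoc, iterKernel_succ, Matrix.mul_apply, Finset.mul_sum]
        refine Finset.sum_congr rfl fun u _ => ?_
        rw [(hK 1 le_rfl).off x hx]; ring
      rw [e1, e2] at h2
      have h3 := mul_le_mul_of_nonneg_left (hW x hx) hq
      push_cast
      nlinarith

lemma half_le_iterKernel_of_lyapunov (hM : LazyReversible M π) {W : V → ℝ} (hW0 : ∀ x, 0 ≤ W x)
    (hW : ∀ x, x ≠ o → ∑ y, M x y * W y ≤ W x - 1) {H : ℝ} (hH : 0 < H) (hWH : ∀ x, W x ≤ H)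
    {n₀ : ℕ} {q : ℝ} (hq : 0 ≤ q) (z : V)
    (hmid : ∀ K : ℕ → Matrix V V ℝ, (∀ i, 1 ≤ i → IsMidPerturbation M o σ (K i)) → ∀ n, n₀ ≤ n →
      q ≤ iterKernel K n o z)
    (hK : ∀ i, 1 ≤ i → IsMidPerturbation M o σ (K i)) {n : ℕ} (hn : n₀ + 2 * H ≤ n) (x : V) :
    q / 2 ≤ iterKernel K n x z := by
  have hn' : n₀ ≤ n := by
    have : (n₀ : ℝ) ≤ n := by linarith
    exact_mod_cast this
  obtain ⟨k, rfl⟩ := Nat.exists_eq_add_of_le hn'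
  push_cast at hn
  have hk : 2 * H ≤ k := by linarith
  have h := iterKernel_ge_of_lyapunov hM hW0 hW hq z hmid k K hK x
  have hk0 : (0 : ℝ) < k := by linarith
  have h2 : q * (k / 2) ≤ k * iterKernel K (n₀ + k) x z :=
    (mul_le_mul_of_nonneg_left (by linarith [hWH x]) hq).trans h
  refine le_of_mul_le_mul_left ?_ hk0
  linarith

end

end Inhomogeneous

/-! ### The merging bound for abstract mid-perturbations. -/

/-- Merging time bound for the mid-perturbations of a reversible kernel that satisfies a Nash
inequality and has a Lyapunov function for the hitting time of `o`. -/
theorem exists_mergingTime_le {D B c : ℝ} (hD : 0 < D) (hB : 0 < B) (hc : 0 < c) :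
    ∃ A : ℝ, 0 < A ∧ ∀ {V : Type} [Fintype V] [DecidableEq V] {M : Matrix V V ℝ} {π : V → ℝ}
      {o : V} {σ : Equiv.Perm V}, LazyReversible M π → (∀ x, σ (σ x) = x) →
      (∀ x y, M (σ x) (σ y) = M x y) → (∀ x, π (σ x) = π x) → σ o = o → ∀ {N : ℕ}, 1 ≤ N →
      (∀ k : ℕ, 4 * k ≤ N → HasPaths M π k B) →
      (∀ S : Finset V, c * (S.card : ℝ) ^ D ≤ (N : ℝ) ^ D * ∑ x ∈ S, π x) →
      ∀ {W : V → ℝ}, (∀ x, 0 ≤ W x) → (∀ x, x ≠ o → ∑ y, M x y * W y ≤ W x - 1) →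
      ∀ {G : ℝ}, (N : ℝ) ^ 2 ≤ G → (∀ x, W x ≤ G) →
      ∀ {K : ℕ → Matrix V V ℝ}, (∀ i, 1 ≤ i → IsMidPerturbation M o σ (K i)) →
      ∀ {η : ℝ}, 0 < η →
        (mergingTime K η : ℝ≥0∞) ≤ ENNReal.ofReal (A * (G * (1 + Real.posLog (1 / η)))) := by
  set κ := 2 / D * ((c / 4) ^ (2 / D) / (12 * B)) with hκ
  have hκ0 : 0 < κ := by positivity
  set C := max (4 ^ (D + 1) / c) 1 with hC
  have hC1 : 1 ≤ C := le_max_right _ _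
  -- `48 C` is the quotient of the upper bound `2 C π z` by the lower bound `π z / 24`.
  have hR : 1 ≤ 48 * C := by linarith
  have hlog : 0 ≤ Real.log (48 * C) := Real.log_nonneg hR
  refine ⟨(2 + 48 * C + 48 * C * Real.log (48 * C)) * (8 + 2 / κ), by positivity, ?_⟩
  intro V _ _ M π o σ hM hσσ hMσ hπσ hσo N hN hpath hvol W hW0 hW G hNG hWG K hK η hη
  have hN1 : (1 : ℝ) ≤ N := by exact_mod_cast hN
  have hG1 : 1 ≤ G := le_trans (by nlinarith) hNG
  have hG0 : 0 < G := by linarith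
  set n₁ := ⌈2 * G⌉₊ with hn₁
  set n₂ := ⌈G / κ⌉₊ with hn₂
  have hn₁' : 2 * G ≤ n₁ := Nat.le_ceil _
  -- One `n₁` makes the lower bound from `o` valid, another lets any start reach `o`; the even time
  -- `n₂ + n₂` serves the heat kernel bound.
  set T := (n₁ + n₁) + (n₂ + n₂) with hT
  have hTle : (T : ℝ) ≤ (8 + 2 / κ) * G := by
    have h1 : (n₁ : ℝ) < 2 * G + 1 := Nat.ceil_lt_add_one (by positivity)
    have h2 : (n₂ : ℝ) < G / κ + 1 := Nat.ceil_lt_add_one (by positivity)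
    have h3 : (8 + 2 / κ) * G = 8 * G + 2 * (G / κ) := by ring
    rw [h3, hT]; push_cast; linarith
  have hupper : ∀ x z, (M ^ T) x z ≤ C * π z := by
    refine hM.pow_le_of_le (m := n₂ + n₂) (by omega)
      (hM.pow_le_of_paths hN hD hB hc hpath hvol ?_)
    have h1 : G / κ ≤ n₂ := Nat.le_ceil _
    rw [div_le_iff₀ hκ0] at h1
    rw [← hκ]
    linarith
  have hMself : IsMidPerturbation M o σ M :=
    ⟨hM.nonneg, hM.row_sum, fun _ _ _ => rfl, fun _ => rfl, fun z => by
      linarith [hM.nonneg o z]⟩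
  -- The Lyapunov argument for the constant sequence `M` with target `o`: the column at `o` is blind
  -- to perturbations, so the diagonal bound for `M` applies to every admissible sequence.
  have hstep1 : ∀ n, n₁ ≤ n → ∀ x, π o / 3 / 2 ≤ (M ^ n) x o := by
    intro n hn x
    rw [← iterKernel_const]
    have hn' : (n₁ : ℝ) ≤ n := by exact_mod_cast hn
    refine half_le_iterKernel_of_lyapunov hM (σ := σ) hW0 hW hG0 hWG (n₀ := 0) (q := π o / 3)
      (by linarith [hM.pos o]) o (fun K hK n _ => ?_) (K := fun _ => M) (fun _ _ => hMself)
      (by rw [Nat.cast_zero, zero_add]; exact hn₁'.trans hn') x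
    rw [iterKernel_mid hσσ hMσ hσo hK]
    exact hM.le_pow_diag n o
  have hstep2 : ∀ z, ∀ K : ℕ → Matrix V V ℝ, (∀ i, 1 ≤ i → IsMidPerturbation M o σ (K i)) →
      ∀ n, n₁ ≤ n → π z / 12 ≤ iterKernel K n o z := by
    intro z K hK n hn
    have h1 := pow_le_two_mul_iterKernel hM hσσ hMσ hσo hK n z
    have h2 := hM.pow_rev n o z
    have h3 := mul_le_mul_of_nonneg_left (hstep1 n hn z) (hM.pos z).le
    have h4 : π z / 6 ≤ (M ^ n) o z := by
      refine le_of_mul_le_mul_left ?_ (hM.pos o)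
      rw [h2]; linarith
    linarith
  have hlower : ∀ K : ℕ → Matrix V V ℝ, (∀ i, 1 ≤ i → IsMidPerturbation M o σ (K i)) →
      ∀ x z, π z / 24 ≤ iterKernel K T x z := by
    intro K hK x z
    have h1 := half_le_iterKernel_of_lyapunov hM hW0 hW hG0 hWG (n₀ := n₁) (q := π z / 12)
      (by linarith [hM.pos z]) z (hstep2 z) hK (n := T) (by rw [hT]; push_cast; linarith) x
    linarith
  have hblock : ∀ K : ℕ → Matrix V V ℝ, (∀ i, 1 ≤ i → IsMidPerturbation M o σ (K i)) →
      ∀ x y z, 0 < iterKernel K T x z ∧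
        iterKernel K T x z ≤ 48 * C * iterKernel K T y z := by
    intro K hK x y z
    have hz := hM.pos z
    have h1 := hlower K hK x z
    have h2 := hlower K hK y z
    -- Nonnegativity bounds one entry by its orbit sum, where `M ^ T` applies; this doubles `C`.
    have h3 := iterKernel_fold hσσ hMσ hK T x z
    have h4 := iterKernel_nonneg (fun i hi => (hK i hi).nonneg) T x (σ z)
    have h5 := hupper x z
    have h6 := hupper x (σ z)
    rw [hπσ] at h6
    refine ⟨by linarith, ?_⟩
    have h7 := mul_le_mul_of_nonneg_left h2 (show 0 ≤ 48 * C by linarith)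
    linarith
  refine (mergingTime_le_of_block (𝒬 := {P | IsMidPerturbation M o σ P}) (fun P hP => hP.nonneg)
    (fun P hP => hP.row_sum) hR hblock hK hη).trans (ENNReal.ofReal_le_ofReal ?_)
  have hL0 : 0 ≤ Real.posLog (1 / η) := Real.posLog_nonneg
  have hcoef : 0 ≤ 2 + 48 * C + 48 * C * Real.log (48 * C) := by positivity
  have h := mul_le_mul_of_nonneg_left (mul_le_mul_of_nonneg_right hTle
    (add_nonneg zero_le_one hL0)) hcoef
  rw [mul_assoc (2 + 48 * C + 48 * C * Real.log (48 * C)), ← mul_assoc (8 + 2 / κ)]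
  exact h

/-! ### Metropolis chains on the segment with radial weights. -/

section Radial

variable {N : ℕ}

/-- The reflection `x ↦ -x` of `V_N`. -/
def reflect (N : ℕ) : Equiv.Perm (Vtx N) where
  toFun x := ⟨-x.1, by have := Finset.mem_Icc.1 x.2; exact Finset.mem_Icc.2 ⟨by omega, by omega⟩⟩
  invFun x := ⟨-x.1, by have := Finset.mem_Icc.1 x.2; exact Finset.mem_Icc.2 ⟨by omega, by omega⟩⟩
  left_inv x := by simp
  right_inv x := by simp

@[simp] lemma reflect_val (x : Vtx N) : (reflect N x).1 = -x.1 := rfl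

/-- The middle vertex of `V_N`. -/
def mid (N : ℕ) : Vtx N := ⟨0, by simp⟩

lemma natAbs_le (x : Vtx N) : x.1.natAbs ≤ N := by
  have := Finset.mem_Icc.1 x.2; omega

lemma card_filter_natAbs_le (S : Finset (Vtx N)) (a : ℕ) :
    (S.filter fun x => x.1.natAbs = a).card ≤ 2 := by
  refine (Finset.card_le_card_of_injOn (t := ({(a : ℤ), -(a : ℤ)} : Finset ℤ)) (fun x => x.1)
    (fun x hx => ?_) (Subtype.val_injective.injOn)).trans Finset.card_le_two
  have := (Finset.mem_filter.1 hx).2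
  simp only [Finset.coe_insert, Finset.coe_singleton, Set.mem_insert_iff, Set.mem_singleton_iff]
  omega

lemma sum_baseWalk_erase_le (x : Vtx N) :
    ∑ z ∈ Finset.univ.erase x, baseWalk N x z ≤ 2 / 3 := by
  have h1 : ∀ z ∈ Finset.univ.erase x, baseWalk N x z = if |x.1 - z.1| = 1 then 1 / 3 else 0 := by
    intro z hz
    simp [baseWalk, Finset.ne_of_mem_erase hz]
  rw [Finset.sum_congr rfl h1, ← Finset.sum_filter, Finset.sum_const, nsmul_eq_mul]
  have h2 : ((Finset.univ.erase x).filter fun z : Vtx N => |x.1 - z.1| = 1).card ≤ 2 := by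
    refine (Finset.card_le_card_of_injOn (t := ({x.1 + 1, x.1 - 1} : Finset ℤ)) (fun x => x.1)
      (fun z hz => ?_) (Subtype.val_injective.injOn)).trans Finset.card_le_two
    have := (Finset.mem_filter.1 hz).2
    simp only [Finset.coe_insert, Finset.coe_singleton, Set.mem_insert_iff, Set.mem_singleton_iff]
    rcases abs_eq (by norm_num : (0 : ℤ) ≤ 1) |>.1 this with h | h <;> omega
  have h3 : (((Finset.univ.erase x).filter fun z : Vtx N => |x.1 - z.1| = 1).card : ℝ) ≤ 2 := by
    exact_mod_cast h2
  linarith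

lemma metropolis_nonneg_off {π : Vtx N → ℝ} (hπ : ∀ x, 0 < π x) {x y : Vtx N} (hxy : y ≠ x) :
    0 ≤ metropolis (baseWalk N) π x y := by
  have : 0 ≤ min 1 (π y / π x) := le_min zero_le_one (div_nonneg (hπ y).le (hπ x).le)
  simp only [metropolis, Matrix.of_apply, if_neg hxy, baseWalk]
  split_ifs <;> linarith

lemma metropolis_mul {π : Vtx N → ℝ} (hπ : ∀ x, 0 < π x) {x y : Vtx N}
    (hxy : |x.1 - y.1| = 1) :
    π x * metropolis (baseWalk N) π x y = 1 / 3 * min (π x) (π y) := by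
  have hne : y ≠ x := by rintro rfl; simp at hxy
  simp only [metropolis, Matrix.of_apply, if_neg hne, baseWalk, if_pos hxy]
  rw [mul_left_comm, mul_min_of_nonneg _ _ (hπ x).le, mul_one, mul_div_cancel₀ _ (hπ x).ne']

lemma metropolis_eq_zero {π : Vtx N → ℝ} {x y : Vtx N} (hne : y ≠ x) (hxy : |x.1 - y.1| ≠ 1) :
    metropolis (baseWalk N) π x y = 0 := by
  simp [metropolis, baseWalk, hne, hxy]

lemma lazyReversible_metropolis {π : Vtx N → ℝ} (hπ : ∀ x, 0 < π x) (hπ1 : ∑ x, π x = 1) :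
    LazyReversible (metropolis (baseWalk N) π) π := by
  have hhold : ∀ x, 1 / 3 ≤ metropolis (baseWalk N) π x x := by
    intro x
    simp only [metropolis, Matrix.of_apply, if_true]
    have h1 : ∑ z ∈ Finset.univ.erase x, baseWalk N x z * min 1 (π z / π x)
        ≤ ∑ z ∈ Finset.univ.erase x, baseWalk N x z := by
      refine Finset.sum_le_sum fun z hz => mul_le_of_le_one_right ?_ (min_le_left _ _)
      simp only [baseWalk, Matrix.of_apply, if_neg (Finset.ne_of_mem_erase hz)]
      split_ifs <;> norm_num
    linarith [sum_baseWalk_erase_le x]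
  refine ⟨fun x y => ?_, fun x => ?_, hπ, hπ1, fun x y => ?_, hhold⟩
  · by_cases hxy : y = x
    · rw [hxy]; linarith [hhold x]
    · exact metropolis_nonneg_off hπ hxy
  · rw [← Finset.add_sum_erase _ _ (Finset.mem_univ x)]
    have : ∀ y ∈ Finset.univ.erase x, metropolis (baseWalk N) π x y
        = baseWalk N x y * min 1 (π y / π x) := fun y hy => by
      simp [metropolis, Finset.ne_of_mem_erase hy]
    rw [Finset.sum_congr rfl this]
    simp [metropolis]
  · by_cases hxy : y = x
    · rw [hxy]
    · by_cases h1 : |x.1 - y.1| = 1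
      · rw [metropolis_mul hπ h1, metropolis_mul hπ (by rwa [abs_sub_comm]), min_comm]
      · rw [metropolis_eq_zero hxy h1, metropolis_eq_zero (Ne.symm hxy) (by rwa [abs_sub_comm])]
        simp

lemma metropolis_reflect {π : Vtx N → ℝ} (hπ : ∀ x, π (reflect N x) = π x) (x y : Vtx N) :
    metropolis (baseWalk N) π (reflect N x) (reflect N y) = metropolis (baseWalk N) π x y := by
  have hb : ∀ x y, baseWalk N (reflect N x) (reflect N y) = baseWalk N x y := by
    intro x y
    have e : |(-x.1) - (-y.1)| = |x.1 - y.1| := by rw [← abs_neg]; congr 1; ring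
    simp only [baseWalk, Matrix.of_apply, EmbeddingLike.apply_eq_iff_eq, reflect_val, abs_neg, e]
  simp only [metropolis, Matrix.of_apply, EmbeddingLike.apply_eq_iff_eq, hb, hπ]
  congr 2
  refine (Finset.sum_bij (fun z _ => reflect N z) (fun z hz => ?_) (fun _ _ _ _ h => ?_)
    (fun z hz => ?_) (fun z _ => ?_)).symm
  · simpa using hz
  · simpa using h
  · exact ⟨(reflect N).symm z, by simpa [Equiv.symm_apply_eq] using hz, by simp⟩
  · rw [hb, hπ]

/-- Each path is a straight walk in a fixed direction, so at time `j` a vertex `u` can only be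
reached from `u ± j`. Both ends of every edge have weight at least `π x / b`; the factor 3 undoes
the proposal probability. -/
lemma hasPaths_metropolis {π : Vtx N → ℝ} (hπ : ∀ x, 0 < π x) {k : ℕ} {b : ℝ} (hb : 0 < b)
    (h : ∀ x : Vtx N, ∃ s : ℤ, (s = 1 ∨ s = -1) ∧ ∀ j : ℕ, j ≤ k →
      ∃ y : Vtx N, y.1 = x.1 + s * j ∧ π x ≤ b * π y) :
    HasPaths (metropolis (baseWalk N) π) π k (3 * b) := by
  choose s hs hy using h
  choose! y hy1 hy2 using hy
  have hval : ∀ x, ∀ j ≤ k, (y x j).1 = x.1 + s x * j := hy1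
  refine ⟨y, fun x => ?_, fun x i hi j hj hij => ?_, fun x j hj => ?_, fun j hj u => ?_⟩
  · have := hval x 0 (Nat.zero_le k)
    exact Subtype.ext (by simpa using this)
  · have h1 := hval x i hi
    have h2 := hval x j hj
    have hij' : y x i = y x j := hij
    rw [hij', h2] at h1
    rcases hs x with h | h <;> rw [h] at h1 <;> omega
  · have h1 := hval x j hj.le
    have h2 := hval x (j + 1) hj
    have h3 : |(y x j).1 - (y x (j + 1)).1| = 1 := by
      rw [h1, h2]; push_cast
      rcases hs x with h | h <;> rw [h] <;> ring_nf <;> simp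
    rw [metropolis_mul hπ h3]
    have h4 : π x / b ≤ min (π (y x j)) (π (y x (j + 1))) :=
      le_min ((div_le_iff₀' hb).2 (hy2 x j hj.le)) ((div_le_iff₀' hb).2 (hy2 x (j + 1) hj))
    rw [div_le_iff₀' hb] at h4
    linarith
  · refine (Finset.card_le_card_of_injOn (t := ({u.1 - j, u.1 + j} : Finset ℤ)) (fun x => x.1)
      (fun x hx => ?_) (Subtype.val_injective.injOn)).trans Finset.card_le_two
    have h1 : y x j = u := (Finset.mem_filter.1 hx).2
    have h2 := hval x j hj.le
    rw [h1] at h2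
    simp only [Finset.coe_insert, Finset.coe_singleton, Set.mem_insert_iff, Set.mem_singleton_iff]
    rcases hs x with h | h <;> rw [h] at h2 <;> omega

lemma sum_midPerturb (hN : 1 ≤ N) (s : ℝ) (x : Vtx N) : ∑ y, midPerturb N s x y = 0 := by
  by_cases hx : x.1 = 0
  · have e : ∀ y : Vtx N, midPerturb N s x y
        = (if y = ⟨1, Finset.mem_Icc.2 ⟨by omega, by omega⟩⟩ then s else 0)
          + (if y = ⟨-1, Finset.mem_Icc.2 ⟨by omega, by omega⟩⟩ then -s else 0) := by
      intro y
      simp only [midPerturb, Matrix.of_apply, hx, true_and, Subtype.ext_iff]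
      split_ifs <;> first | omega | simp
    simp [e, Finset.sum_add_distrib]
  · simp [midPerturb, hx]

lemma isMidPerturbation_of_mem (hN : 1 ≤ N) {M P : Matrix (Vtx N) (Vtx N) ℝ} {π : Vtx N → ℝ}
    (hM : LazyReversible M π) {ε : ℝ} (hε : ∀ y : Vtx N, y.1.natAbs = 1 → 2 * ε ≤ M (mid N) y)
    (hP : P ∈ perturbSet M ε) : IsMidPerturbation M (mid N) (reflect N) P := by
  obtain ⟨s, ⟨hs1, hs2⟩, rfl⟩ := hP
  have hhalf : ∀ z, M (mid N) z ≤ 2 * (M + midPerturb N s) (mid N) z := by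
    intro z
    have h0 := hM.nonneg (mid N) z
    simp only [Matrix.add_apply, midPerturb, Matrix.of_apply]
    split_ifs with h1 h2
    · have := hε z (by omega)
      linarith
    · have := hε z (by omega)
      linarith
    · linarith
  have hoff : ∀ x, x ≠ mid N → ∀ y, (M + midPerturb N s) x y = M x y := by
    intro x hx y
    have : x.1 ≠ 0 := fun h => hx (Subtype.ext h)
    simp [midPerturb, this]
  refine ⟨fun x y => ?_, fun x => ?_, hoff, fun z => ?_, hhalf⟩
  · by_cases hx : x = mid N
    · rw [hx]; linarith [hhalf y, hM.nonneg (mid N) y]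
    · rw [hoff x hx]; exact hM.nonneg x y
  · simp only [Matrix.add_apply, Finset.sum_add_distrib, hM.row_sum, sum_midPerturb hN, add_zero]
  · simp only [Matrix.add_apply, midPerturb, Matrix.of_apply, reflect_val, mid, true_and]
    split_ifs <;> first | omega | ring

/-- A radial function is a Lyapunov function for the hitting time of the middle vertex as soon as
its increments satisfy a one-sided flow inequality. -/
lemma metropolis_lyapunov {π : Vtx N → ℝ} {p : ℕ → ℝ}
    (hπ : ∀ x, π x = p x.1.natAbs) {d : ℕ → ℝ}
    (hd : ∀ a, 1 ≤ a → a ≤ N → p a + (if a < N then d (a + 1) * min (p a) (p (a + 1)) else 0) / 3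
      ≤ d a * min (p a) (p (a - 1)) / 3) (hM : LazyReversible (metropolis (baseWalk N) π) π)
    {x : Vtx N} (hx : x ≠ mid N) :
    ∑ y, metropolis (baseWalk N) π x y * ∑ j ∈ Finset.range y.1.natAbs, d (j + 1)
      ≤ ∑ j ∈ Finset.range x.1.natAbs, d (j + 1) - 1 := by
  set M := metropolis (baseWalk N) π with hMdef
  set U : ℕ → ℝ := fun a => ∑ j ∈ Finset.range a, d (j + 1) with hU
  have hx0 : x.1 ≠ 0 := fun h => hx (Subtype.ext h)
  set a := x.1.natAbs with ha
  have ha1 : 1 ≤ a := by omega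
  have haN : a ≤ N := natAbs_le x
  have hπx := hM.pos
  suffices h : ∑ y, π x * M x y * (U y.1.natAbs - U a) ≤ -π x by
    have e : ∑ y, π x * M x y * (U y.1.natAbs - U a) = π x * (∑ y, M x y * U y.1.natAbs - U a) := by
      simp only [mul_sub, Finset.sum_sub_distrib, mul_assoc, ← Finset.mul_sum]
      rw [← Finset.sum_mul, hM.row_sum, one_mul]
    rw [e] at h
    have h2 : ∑ y, M x y * U y.1.natAbs - U a ≤ -1 :=
      le_of_mul_le_mul_left (by linarith) (hπx x)
    show ∑ y, M x y * U y.1.natAbs ≤ U a - 1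
    linarith
  have hzero : ∀ y : Vtx N, |x.1 - y.1| ≠ 1 → π x * M x y * (U y.1.natAbs - U a) = 0 := by
    intro y hy
    by_cases hyx : y = x
    · rw [hyx]; simp [ha]
    · rw [hMdef, metropolis_eq_zero hyx hy]; simp
  have hxIcc := Finset.mem_Icc.1 x.2
  -- Only the inward neighbour `u` and, when `a < N`, an outward one contribute to the drift.
  obtain ⟨u, hu⟩ : ∃ u : Vtx N, u.1 = x.1 - x.1.sign :=
    ⟨⟨x.1 - x.1.sign, Finset.mem_Icc.2 (by
      rcases lt_or_gt_of_ne hx0 with h | h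
      · rw [Int.sign_eq_neg_one_of_neg h]; omega
      · rw [Int.sign_eq_one_of_pos h]; omega)⟩, rfl⟩
  have huabs : u.1.natAbs = a - 1 := by
    rcases lt_or_gt_of_ne hx0 with h | h
    · rw [Int.sign_eq_neg_one_of_neg h] at hu; omega
    · rw [Int.sign_eq_one_of_pos h] at hu; omega
  have hxu : |x.1 - u.1| = 1 := by
    rw [hu, sub_sub_cancel, Int.abs_sign_of_ne_zero hx0]
  have hUu : U (a - 1) - U a = -d a := by
    obtain ⟨m, hm⟩ : ∃ m, a = m + 1 := ⟨a - 1, by omega⟩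
    simp only [hU, hm, Nat.add_sub_cancel, Finset.sum_range_succ]; ring
  have htu : π x * M x u * (U u.1.natAbs - U a) = -(d a * min (p a) (p (a - 1)) / 3) := by
    rw [hMdef, metropolis_mul hπx hxu, huabs, hUu, hπ x, hπ u, huabs]; ring
  have hda := hd a ha1 haN
  rw [hπ x]
  by_cases haN' : a < N
  · obtain ⟨v, hv⟩ : ∃ v : Vtx N, v.1 = x.1 + x.1.sign :=
      ⟨⟨x.1 + x.1.sign, Finset.mem_Icc.2 (by
        rcases lt_or_gt_of_ne hx0 with h | h
        · rw [Int.sign_eq_neg_one_of_neg h]; omega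
        · rw [Int.sign_eq_one_of_pos h]; omega)⟩, rfl⟩
    have hvabs : v.1.natAbs = a + 1 := by
      rcases lt_or_gt_of_ne hx0 with h | h
      · rw [Int.sign_eq_neg_one_of_neg h] at hv; omega
      · rw [Int.sign_eq_one_of_pos h] at hv; omega
    have hxv : |x.1 - v.1| = 1 := by
      rw [hv, sub_add_cancel_left, abs_neg, Int.abs_sign_of_ne_zero hx0]
    have hUv : U (a + 1) - U a = d (a + 1) := by
      simp only [hU, Finset.sum_range_succ]; ring
    have htv : π x * M x v * (U v.1.natAbs - U a) = d (a + 1) * min (p a) (p (a + 1)) / 3 := by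
      rw [hMdef, metropolis_mul hπx hxv, hvabs, hUv, hπ x, hπ v, hvabs]; ring
    have huv : u ≠ v := by intro h; rw [h] at huabs; omega
    rw [if_pos haN'] at hda
    have hsum := Finset.sum_subset (Finset.subset_univ {u, v})
      (f := fun y => π x * M x y * (U y.1.natAbs - U a)) (fun y _ hy => hzero y fun hxy => by
        simp only [Finset.mem_insert, Finset.mem_singleton, not_or, Subtype.ext_iff] at hy
        rw [hu, hv] at hy
        rcases lt_or_gt_of_ne hx0 with h | h
        · rw [Int.sign_eq_neg_one_of_neg h] at hy
          rcases abs_eq (by norm_num : (0 : ℤ) ≤ 1) |>.1 hxy with h | h <;> omega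
        · rw [Int.sign_eq_one_of_pos h] at hy
          rcases abs_eq (by norm_num : (0 : ℤ) ≤ 1) |>.1 hxy with h | h <;> omega)
    rw [Finset.sum_pair huv] at hsum
    rw [← hπ x, ← hsum, htu, htv, hπ x]
    linarith
  · rw [if_neg haN'] at hda
    have hsum := Finset.sum_subset (Finset.subset_univ {u})
      (f := fun y => π x * M x y * (U y.1.natAbs - U a)) (fun y _ hy => hzero y fun hxy => by
        simp only [Finset.mem_singleton, Subtype.ext_iff] at hy
        rw [hu] at hy
        have hyIcc := Finset.mem_Icc.1 y.2
        rcases lt_or_gt_of_ne hx0 with h | h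
        · rw [Int.sign_eq_neg_one_of_neg h] at hy
          rcases abs_eq (by norm_num : (0 : ℤ) ≤ 1) |>.1 hxy with h | h <;> omega
        · rw [Int.sign_eq_one_of_pos h] at hy
          rcases abs_eq (by norm_num : (0 : ℤ) ≤ 1) |>.1 hxy with h | h <;> omega)
    rw [Finset.sum_singleton] at hsum
    rw [← hπ x, ← hsum, htu, hπ x]
    linarith

lemma card_filter_radius_le {ρ : ℕ → ℕ} (hρ1 : ∀ a ≤ N, 1 ≤ ρ a)
    (hρ : Set.InjOn ρ (Set.Iic N)) (S : Finset (Vtx N)) (j : ℕ) :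
    (S.filter fun x => ρ x.1.natAbs ≤ j).card ≤ 2 * j := by
  have h1 : ((S.filter fun x => ρ x.1.natAbs ≤ j).image fun x => ρ x.1.natAbs).card ≤ j := by
    have : ((S.filter fun x => ρ x.1.natAbs ≤ j).image fun x => ρ x.1.natAbs)
        ⊆ Finset.Icc 1 j := by
      intro r hr
      obtain ⟨x, hx, rfl⟩ := Finset.mem_image.1 hr
      exact Finset.mem_Icc.2 ⟨hρ1 _ (natAbs_le x), (Finset.mem_filter.1 hx).2⟩
    simpa using Finset.card_le_card this
  refine (Finset.card_le_mul_card_image _ 2 fun r hr => ?_).trans (Nat.mul_le_mul_left 2 h1)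
  obtain ⟨x, hx, rfl⟩ := Finset.mem_image.1 hr
  refine (Finset.card_le_card fun y hy => ?_).trans
    (card_filter_natAbs_le (S.filter fun x => ρ x.1.natAbs ≤ j) x.1.natAbs)
  obtain ⟨hy1, hy2⟩ := Finset.mem_filter.1 hy
  exact Finset.mem_filter.2 ⟨hy1, hρ (natAbs_le y) (natAbs_le x) hy2⟩

/-- Volume lower bound for sets of given cardinality under a radial power weight. -/
lemma volume_ge {α : ℝ} (hα : 0 ≤ α) (hN : 1 ≤ N) {ρ : ℕ → ℕ} (hρ1 : ∀ a ≤ N, 1 ≤ ρ a)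
    (hρN : ∀ a ≤ N, ρ a ≤ N + 1) (hρ : Set.InjOn ρ (Set.Iic N)) (S : Finset (Vtx N)) :
    1 / (6 * 8 ^ α) * (S.card : ℝ) ^ (1 + α) ≤ (N : ℝ) ^ (1 + α) *
      ∑ x ∈ S, normalized (fun x : Vtx N => (ρ x.1.natAbs : ℝ) ^ α) x := by
  set w : Vtx N → ℝ := fun x => (ρ x.1.natAbs : ℝ) ^ α with hw
  have hN1 : (1 : ℝ) ≤ N := by exact_mod_cast hN
  have hN0 : (0 : ℝ) < N := by linarith
  have hw0 : ∀ x, 0 < w x := fun x => Real.rpow_pos_of_pos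
    (by have := hρ1 _ (natAbs_le x); exact_mod_cast this) α
  have hZ : ∑ x, w x ≤ 3 * N * (2 * N) ^ α := by
    have h1 : ∀ x ∈ Finset.univ, w x ≤ (2 * N : ℝ) ^ α := fun x _ => by
      refine Real.rpow_le_rpow (Nat.cast_nonneg _) ?_ hα
      have h2 := hρN _ (natAbs_le x)
      have : (ρ x.1.natAbs : ℝ) ≤ N + 1 := by exact_mod_cast h2
      linarith
    refine (Finset.sum_le_card_nsmul _ _ _ h1).trans ?_
    rw [nsmul_eq_mul]
    refine mul_le_mul_of_nonneg_right ?_ (by positivity)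
    have h2 : (Finset.univ : Finset (Vtx N)).card = 2 * N + 1 := by
      rw [Finset.card_univ, Fintype.card_coe, Int.card_Icc]; omega
    rw [h2]; push_cast; linarith
  have hZ0 : 0 < ∑ x, w x := Finset.sum_pos (fun x _ => hw0 x) ⟨mid N, Finset.mem_univ _⟩
  have hS : (S.card : ℝ) / 2 * (S.card / 4) ^ α ≤ ∑ x ∈ S, w x := by
    -- At most `2j` vertices have radius label at most `j`, so at least half of `S` has label above
    -- `j`, hence weight at least `(S.card / 4) ^ α`.
    set j := S.card / 4 with hj
    have h1 := card_filter_radius_le hρ1 hρ S j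
    have h2 := Finset.card_filter_add_card_filter_not (s := S) (fun x => ρ x.1.natAbs ≤ j)
    have h3 : S.card ≤ 2 * (S.filter fun x => ¬ ρ x.1.natAbs ≤ j).card := by omega
    have h4 : (S.card : ℝ) / 2 ≤ (S.filter fun x => ¬ ρ x.1.natAbs ≤ j).card := by
      rw [div_le_iff₀ (by norm_num), mul_comm]; exact_mod_cast h3
    calc (S.card : ℝ) / 2 * (S.card / 4) ^ α
        ≤ (S.filter fun x => ¬ ρ x.1.natAbs ≤ j).card * (S.card / 4) ^ α :=
          mul_le_mul_of_nonneg_right h4 (by positivity)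
      _ ≤ ∑ x ∈ S.filter fun x => ¬ ρ x.1.natAbs ≤ j, w x := by
          rw [← nsmul_eq_mul]
          refine Finset.card_nsmul_le_sum _ _ _ fun x hx => ?_
          refine Real.rpow_le_rpow (by positivity) ?_ hα
          have h5 := (Finset.mem_filter.1 hx).2
          have h6 : S.card ≤ 4 * ρ x.1.natAbs := by omega
          rw [div_le_iff₀ (by norm_num), mul_comm]; exact_mod_cast h6
      _ ≤ ∑ x ∈ S, w x := Finset.sum_le_sum_of_subset_of_nonneg (Finset.filter_subset _ _)
          fun x _ _ => (hw0 x).le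
  have e1 : ∑ x ∈ S, normalized w x = (∑ x ∈ S, w x) / ∑ x, w x := by
    simp only [normalized, Finset.sum_div]
  have h8 : (8 : ℝ) ^ α = 2 ^ α * 4 ^ α := by
    rw [← Real.mul_rpow (by norm_num) (by norm_num)]; norm_num
  have hk : (S.card : ℝ) ^ (1 + α) = S.card * (S.card : ℝ) ^ α := by
    rw [Real.rpow_add' (Nat.cast_nonneg _) (by linarith), Real.rpow_one]
  rw [e1, mul_div_assoc', le_div_iff₀ hZ0, hk, Real.rpow_add hN0, Real.rpow_one, h8]
  rw [Real.div_rpow (Nat.cast_nonneg _) (by norm_num)] at hS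
  rw [Real.mul_rpow (by norm_num) hN0.le] at hZ
  have p2 : (0 : ℝ) < 2 ^ α := by positivity
  have p4 : (0 : ℝ) < 4 ^ α := by positivity
  calc 1 / (6 * (2 ^ α * 4 ^ α)) * (S.card * (S.card : ℝ) ^ α) * ∑ x, w x
      ≤ 1 / (6 * (2 ^ α * 4 ^ α)) * (S.card * (S.card : ℝ) ^ α) * (3 * N * (2 ^ α * N ^ α)) :=
        mul_le_mul_of_nonneg_left hZ (by positivity)
    _ = N * (N : ℝ) ^ α * ((S.card : ℝ) / 2 * ((S.card : ℝ) ^ α / 4 ^ α)) := by field_simp; ring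
    _ ≤ N * (N : ℝ) ^ α * ∑ x ∈ S, w x := mul_le_mul_of_nonneg_left hS (by positivity)

end Radial

/-- Merging time bound for mid-perturbations of the Metropolis chain of a radial power weight
`(ρ |x|) ^ α`, in terms of the increments `d` of a radial Lyapunov function. -/
theorem exists_mergingTime_le_radial {α : ℝ} (hα : 0 ≤ α) :
    ∃ A : ℝ, 0 < A ∧ ∀ {N : ℕ}, 1 ≤ N → ∀ {ρ : ℕ → ℕ}, (∀ a ≤ N, 1 ≤ ρ a) →
      (∀ a ≤ N, ρ a ≤ N + 1) → Set.InjOn ρ (Set.Iic N) →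
      (∀ k a : ℕ, 4 * k ≤ N → a ≤ N → (a + k ≤ N ∧ ∀ j ≤ k, ρ a ≤ 4 * ρ (a + j)) ∨
        (k ≤ a ∧ ∀ j ≤ k, ρ a ≤ 4 * ρ (a - j))) →
      ∀ {d : ℕ → ℝ}, (∀ a, 0 ≤ d a) →
      (∀ a, 1 ≤ a → a ≤ N → (ρ a : ℝ) ^ α
          + (if a < N then d (a + 1) * min ((ρ a : ℝ) ^ α) ((ρ (a + 1) : ℝ) ^ α) else 0) / 3
        ≤ d a * min ((ρ a : ℝ) ^ α) ((ρ (a - 1) : ℝ) ^ α) / 3) →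
      ∀ {G : ℝ}, (N : ℝ) ^ 2 ≤ G → ∑ j ∈ Finset.range N, d (j + 1) ≤ G →
      ∀ {ε : ℝ}, 6 * ε ≤ min 1 ((ρ 1 : ℝ) ^ α / (ρ 0 : ℝ) ^ α) →
      ∀ {K : ℕ → Matrix (Vtx N) (Vtx N) ℝ},
      (∀ i, 1 ≤ i → K i ∈ perturbSet (metropolis (baseWalk N)
        (normalized fun x : Vtx N => (ρ x.1.natAbs : ℝ) ^ α)) ε) →
      ∀ {η : ℝ}, 0 < η →
        (mergingTime K η : ℝ≥0∞) ≤ ENNReal.ofReal (A * (G * (1 + Real.posLog (1 / η)))) := by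
  -- `D` is the volume dimension of the weight; `4 ^ α` in `B` comes from comparing radii within a
  -- factor 4; `c` combines the bounds of `volume_ge`.
  obtain ⟨A, hA, h⟩ := exists_mergingTime_le (D := 1 + α) (B := 3 * 4 ^ α)
    (c := 1 / (6 * 8 ^ α)) (by linarith) (by positivity) (by positivity)
  refine ⟨A, hA, ?_⟩
  intro N hN ρ hρ1 hρN hρ hρpath d hd0 hd G hNG hdG ε hε K hK η hη
  set w : Vtx N → ℝ := fun x => (ρ x.1.natAbs : ℝ) ^ α with hw
  have hρpos : ∀ a ≤ N, 0 < (ρ a : ℝ) ^ α := fun a ha => Real.rpow_pos_of_pos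
    (by have := hρ1 a ha; exact_mod_cast this) α
  have hw0 : ∀ x, 0 < w x := fun x => hρpos _ (natAbs_le x)
  have hZ0 : 0 < ∑ x, w x := Finset.sum_pos (fun x _ => hw0 x) ⟨mid N, Finset.mem_univ _⟩
  set Z := ∑ x, w x with hZ
  set π := normalized w with hπ
  have hπw : ∀ x, π x = w x / Z := fun x => rfl
  have hπ0 : ∀ x, 0 < π x := fun x => div_pos (hw0 x) hZ0
  have hπ1 : ∑ x, π x = 1 := by
    simp only [hπw, ← Finset.sum_div]; exact div_self hZ0.ne'
  have hπr : ∀ x, π (reflect N x) = π x := fun x => by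
    simp only [hπw, hw, reflect_val, Int.natAbs_neg]
  have hM := lazyReversible_metropolis hπ0 hπ1
  have hmid : reflect N (mid N) = mid N := Subtype.ext (by simp [mid])
  have hrr : ∀ x, reflect N (reflect N x) = x := fun x => Subtype.ext (by simp)
  have hπcmp : ∀ x y : Vtx N, ρ x.1.natAbs ≤ 4 * ρ y.1.natAbs → π x ≤ 4 ^ α * π y := by
    intro x y hxy
    rw [hπw, hπw, mul_div_assoc']
    refine div_le_div_of_nonneg_right ?_ hZ0.le
    rw [hw, ← Real.mul_rpow (by norm_num) (Nat.cast_nonneg _)]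
    exact Real.rpow_le_rpow (Nat.cast_nonneg _) (by exact_mod_cast hxy) hα
  refine h hM hrr (metropolis_reflect hπr) hπr hmid hN (fun k hk => ?_)
    (volume_ge hα hN hρ1 hρN hρ) (W := fun x => ∑ j ∈ Finset.range x.1.natAbs, d (j + 1))
    (fun x => Finset.sum_nonneg fun j _ => hd0 _) (fun x hx => ?_) hNG (fun x => ?_)
    (fun i hi => isMidPerturbation_of_mem hN hM (fun y hy => ?_) (hK i hi)) hη
  · refine hasPaths_metropolis hπ0 (by positivity) fun x => ?_
    have hxI := Finset.mem_Icc.1 x.2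
    rcases hρpath k x.1.natAbs hk (natAbs_le x) with ⟨h1, h2⟩ | ⟨h1, h2⟩
    · rcases le_total 0 x.1 with hx | hx
      · refine ⟨1, Or.inl rfl, fun j hj => ⟨⟨x.1 + 1 * j, Finset.mem_Icc.2 ⟨by omega, by omega⟩⟩,
          rfl, hπcmp _ _ ?_⟩⟩
        have e : (x.1 + 1 * (j : ℤ)).natAbs = x.1.natAbs + j := by omega
        simp only [e]; exact h2 j hj
      · refine ⟨-1, Or.inr rfl, fun j hj => ⟨⟨x.1 + -1 * j, Finset.mem_Icc.2 ⟨by omega, by omega⟩⟩,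
          rfl, hπcmp _ _ ?_⟩⟩
        have e : (x.1 + -1 * (j : ℤ)).natAbs = x.1.natAbs + j := by omega
        simp only [e]; exact h2 j hj
    · rcases le_total 0 x.1 with hx | hx
      · refine ⟨-1, Or.inr rfl, fun j hj => ⟨⟨x.1 + -1 * j, Finset.mem_Icc.2 ⟨by omega, by omega⟩⟩,
          rfl, hπcmp _ _ ?_⟩⟩
        have e : (x.1 + -1 * (j : ℤ)).natAbs = x.1.natAbs - j := by omega
        simp only [e]; exact h2 j hj
      · refine ⟨1, Or.inl rfl, fun j hj => ⟨⟨x.1 + 1 * j, Finset.mem_Icc.2 ⟨by omega, by omega⟩⟩,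
          rfl, hπcmp _ _ ?_⟩⟩
        have e : (x.1 + 1 * (j : ℤ)).natAbs = x.1.natAbs - j := by omega
        simp only [e]; exact h2 j hj
  · refine metropolis_lyapunov (p := fun a => (ρ a : ℝ) ^ α / Z) (fun x => rfl)
      (fun a ha1 haN => ?_) hM hx
    have h1 := div_le_div_of_nonneg_right (hd a ha1 haN) hZ0.le
    simp only [min_div_div_right hZ0.le]
    refine (le_of_eq ?_).trans (h1.trans (le_of_eq ?_))
    · split_ifs <;> ring
    · ring
  · exact (Finset.sum_le_sum_of_subset_of_nonneg (Finset.range_mono (natAbs_le x))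
      fun j _ _ => hd0 _).trans hdG
  · have h1 : |(mid N).1 - y.1| = 1 := by
      rw [Int.abs_eq_natAbs]; simp [mid, hy]
    have h2 := metropolis_mul hπ0 h1
    have h3 : π (mid N) = (ρ 0 : ℝ) ^ α / Z := rfl
    have h4 : π y = (ρ 1 : ℝ) ^ α / Z := by rw [hπw, hw]; simp only [hy]
    refine le_of_mul_le_mul_left ?_ (hπ0 (mid N))
    rw [h2, h3, h4, min_div_div_right hZ0.le]
    have h5 := mul_le_mul_of_nonneg_left hε (hρpos 0 (Nat.zero_le N)).le
    rw [mul_min_of_nonneg _ _ (hρpos 0 (Nat.zero_le N)).le, mul_one,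
      mul_div_cancel₀ _ (hρpos 0 (Nat.zero_le N)).ne'] at h5
    rw [div_mul_eq_mul_div, mul_div_assoc']
    refine div_le_div_of_nonneg_right ?_ hZ0.le
    linarith

/-! ### The two families of weights. -/

lemma abs_cast_eq_natAbs (x : ℤ) : |(x : ℝ)| = (x.natAbs : ℝ) := by
  rw [Nat.cast_natAbs, Int.cast_abs]

/-- The weight peaks at 0, so linear increments suffice: the flow through the edge below `a` is `(N
- a + 1) π`, and the outward one at most `(N - a) π`. Hence `W ≤ 3 N ^ 2`. Paths go inward when
there is room; otherwise the start is within `N / 4` of 0 and going outward changes the weight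
little. -/
theorem exists_mergingTime_le_hat {α : ℝ} (hα : 0 ≤ α) :
    ∃ A : ℝ, 0 < A ∧ ∀ N : ℕ, 1 ≤ N → ∀ K : ℕ → Matrix (Vtx N) (Vtx N) ℝ,
      (∀ i : ℕ, 1 ≤ i → K i ∈ perturbSet (MHat α N) (epsHat α N)) → ∀ η : ℝ, 0 < η →
        (mergingTime K η : ℝ≥0∞) ≤
          ENNReal.ofReal (A * ((N : ℝ) ^ 2 * (1 + Real.posLog (1 / η)))) := by
  obtain ⟨A, hA, h⟩ := exists_mergingTime_le_radial hα
  refine ⟨A * 3, by positivity, fun N hN K hK η hη => ?_⟩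
  have hpi : piHat α N = normalized fun x : Vtx N => ((N - x.1.natAbs + 1 : ℕ) : ℝ) ^ α := by
    unfold piHat
    congr 1; funext x
    rw [abs_cast_eq_natAbs]; push_cast [Nat.cast_sub (natAbs_le x)]; rfl
  rw [MHat, hpi] at hK
  have hmono : ∀ a, 1 ≤ a →
      (((N - a + 1 : ℕ) : ℝ)) ^ α ≤ ((N - (a - 1) + 1 : ℕ) : ℝ) ^ α := fun a ha =>
    Real.rpow_le_rpow (Nat.cast_nonneg _) (by exact_mod_cast (by omega)) hα
  have hfin := h hN (ρ := fun a => N - a + 1) (fun a _ => by omega) (fun a _ => by omega)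
    (fun a ha b hb hab => by
      simp only [Set.mem_Iic] at ha hb
      have hab' : N - a + 1 = N - b + 1 := hab
      omega)
    (fun k a hk ha => by
      rcases le_or_gt k a with hka | hka
      · exact Or.inr ⟨hka, fun j hj => by omega⟩
      · exact Or.inl ⟨by omega, fun j hj => by omega⟩)
    (d := fun a => 3 * ((N - a + 1 : ℕ) : ℝ)) (fun a => by positivity)
    (fun a ha1 haN => ?_) (G := 3 * (N : ℝ) ^ 2) (by nlinarith [sq_nonneg (N : ℝ)]) ?_
    (ε := epsHat α N) ?_ hK hη
  · refine hfin.trans (ENNReal.ofReal_le_ofReal (le_of_eq (by ring)))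
  · rw [min_eq_left (hmono a ha1)]
    set y := (((N - a + 1 : ℕ) : ℝ)) ^ α with hy
    have hy0 : 0 ≤ y := by positivity
    have e1 : ((N - a + 1 : ℕ) : ℝ) = (N : ℝ) - a + 1 := by push_cast [Nat.cast_sub haN]; ring
    split_ifs with haN'
    · have e2 : ((N - (a + 1) + 1 : ℕ) : ℝ) = (N : ℝ) - a := by
        rw [show N - (a + 1) + 1 = N - a by omega, Nat.cast_sub haN]
      have h1 : min y (((N - (a + 1) + 1 : ℕ) : ℝ) ^ α) ≤ y := min_le_left _ _
      have h2 : (0 : ℝ) ≤ (N : ℝ) - a := by rw [← e2]; positivity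
      have h3 := mul_le_mul_of_nonneg_left h1 h2
      rw [e1, e2] at *
      nlinarith
    · have : (0 : ℝ) ≤ (N : ℝ) - a := sub_nonneg.2 (by exact_mod_cast haN)
      rw [e1]; nlinarith
  · have h1 : ∀ j ∈ Finset.range N, 3 * ((N - (j + 1) + 1 : ℕ) : ℝ) ≤ 3 * (N : ℝ) := by
      intro j hj
      have : N - (j + 1) + 1 ≤ N := by have := Finset.mem_range.1 hj; omega
      have : ((N - (j + 1) + 1 : ℕ) : ℝ) ≤ N := by exact_mod_cast this
      linarith
    refine (Finset.sum_le_card_nsmul _ _ _ h1).trans (le_of_eq ?_)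
    rw [Finset.card_range, nsmul_eq_mul]; ring
  · have e1 : ((N - 1 + 1 : ℕ) : ℝ) = N := by rw [Nat.sub_add_cancel hN]
    have e0 : ((N - 0 + 1 : ℕ) : ℝ) = (N : ℝ) + 1 := by push_cast; simp
    simp only [e1, e0]
    rw [← Real.div_rpow (Nat.cast_nonneg _) (by positivity), epsHat]
    refine le_min ?_ (by linarith)
    have : ((N : ℝ) / (N + 1)) ^ α ≤ 1 := Real.rpow_le_one (by positivity)
      ((div_le_one (by positivity)).2 (by linarith)) hα
    linarith

theorem exists_mergingTime_le_check {α : ℝ} (hα : 0 ≤ α) :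
    ∃ A : ℝ, 0 < A ∧ ∀ {N : ℕ}, 1 ≤ N → ∀ {G : ℝ}, (N : ℝ) ^ 2 ≤ G →
      3 * N * (2 * N : ℝ) ^ α * ∑ j ∈ Finset.range N, ((j + 1 : ℝ) ^ α)⁻¹ ≤ G →
      ∀ {K : ℕ → Matrix (Vtx N) (Vtx N) ℝ},
      (∀ i : ℕ, 1 ≤ i → K i ∈ perturbSet (MCheck α N) epsCheck) → ∀ {η : ℝ}, 0 < η →
        (mergingTime K η : ℝ≥0∞) ≤
          ENNReal.ofReal (A * (G * (1 + Real.posLog (1 / η)))) := by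
  obtain ⟨A, hA, h⟩ := exists_mergingTime_le_radial hα
  refine ⟨A, by positivity, fun {N} hN {G} hNG hG {K} hK {η} hη => ?_⟩
  have hN1 : (1 : ℝ) ≤ N := by exact_mod_cast hN
  have hpi : piCheck α N = normalized fun x : Vtx N => ((x.1.natAbs + 1 : ℕ) : ℝ) ^ α := by
    unfold piCheck
    congr 1; funext x
    rw [abs_cast_eq_natAbs]; push_cast; rfl
  rw [MCheck, hpi] at hK
  have hmono : ∀ a b : ℕ, a ≤ b → (a : ℝ) ^ α ≤ (b : ℝ) ^ α := fun a b hab =>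
    Real.rpow_le_rpow (Nat.cast_nonneg _) (by exact_mod_cast hab) hα
  refine h hN (ρ := fun a => a + 1) (fun a _ => by omega) (fun a _ => by omega)
    (fun a _ b _ hab => by
      have hab' : a + 1 = b + 1 := hab
      omega)
    (fun k a hk ha => by
      rcases le_or_gt (a + k) N with hka | hka
      · exact Or.inl ⟨hka, fun j hj => by omega⟩
      · exact Or.inr ⟨by omega, fun j hj => by omega⟩)
    -- The edge between `a - 1` and `a` has weight `a ^ α`, so the flow is `(N + 1 - a) (N + 1) ^
    -- α`. It drops by `(N + 1) ^ α`, which dominates every vertex weight.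
    (d := fun a => 3 * ((N + 1 - a : ℕ) : ℝ) * (((N + 1 : ℕ) : ℝ) ^ α * ((a : ℝ) ^ α)⁻¹))
    (fun a => by positivity)
    (fun a ha1 haN => ?_) hNG (le_trans ?_ hG) (ε := epsCheck) ?_ hK hη
  · rw [Nat.sub_add_cancel ha1, min_eq_right (hmono a (a + 1) (by omega))]
    have ha0 : (0 : ℝ) < (a : ℝ) ^ α :=
      Real.rpow_pos_of_pos (by exact_mod_cast ha1) α
    have ha0' : (0 : ℝ) < ((a + 1 : ℕ) : ℝ) ^ α := Real.rpow_pos_of_pos (by positivity) α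
    have e1 : ((N + 1 - a : ℕ) : ℝ) = (N : ℝ) + 1 - a := by
      rw [Nat.cast_sub (by omega)]; push_cast; ring
    have hle := hmono (a + 1) (N + 1) (by omega)
    set y := ((N + 1 : ℕ) : ℝ) ^ α with hy
    have hR : 3 * ((N + 1 - a : ℕ) : ℝ) * (y * ((a : ℝ) ^ α)⁻¹) * (a : ℝ) ^ α / 3
        = ((N : ℝ) + 1 - a) * y := by rw [e1]; field_simp
    rw [hR]
    split_ifs with haN'
    · rw [min_eq_left (hmono (a + 1) (a + 1 + 1) (by omega))]
      have e2 : ((N + 1 - (a + 1) : ℕ) : ℝ) = (N : ℝ) - a := by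
        rw [Nat.add_sub_add_right, Nat.cast_sub haN]
      have hL : 3 * ((N + 1 - (a + 1) : ℕ) : ℝ) * (y * (((a + 1 : ℕ) : ℝ) ^ α)⁻¹)
          * ((a + 1 : ℕ) : ℝ) ^ α / 3 = ((N : ℝ) - a) * y := by rw [e2]; field_simp
      rw [hL]; linarith
    · have : (0 : ℝ) ≤ (N : ℝ) - a := sub_nonneg.2 (by exact_mod_cast haN)
      nlinarith [mul_nonneg this (ha0'.le.trans hle)]
  · rw [Finset.mul_sum]
    refine Finset.sum_le_sum fun j _ => ?_
    have h1 : ((N + 1 - (j + 1) : ℕ) : ℝ) ≤ N := by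
      rw [Nat.add_sub_add_right]; exact_mod_cast Nat.sub_le N j
    have h2 : ((N + 1 : ℕ) : ℝ) ^ α ≤ (2 * N : ℝ) ^ α :=
      Real.rpow_le_rpow (Nat.cast_nonneg _) (by push_cast; linarith) hα
    have e : (((j + 1 : ℕ) : ℝ) ^ α)⁻¹ = (((j : ℝ) + 1) ^ α)⁻¹ := by push_cast; rfl
    rw [e, ← mul_assoc]
    gcongr
  · have h1 : (1 : ℝ) ≤ ((1 + 1 : ℕ) : ℝ) ^ α / ((0 + 1 : ℕ) : ℝ) ^ α := by
      norm_num
      exact Real.one_le_rpow (by norm_num) hα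
    rw [min_eq_left h1, epsCheck]; norm_num

/-- Bernoulli's inequality for the exponent `1 - α` replaces comparison with an integral. -/
lemma sum_inv_rpow_le {α : ℝ} (hα0 : 0 ≤ α) (hα : α < 1) (N : ℕ) :
    ∑ j ∈ Finset.range N, ((j + 1 : ℝ) ^ α)⁻¹ ≤ (N : ℝ) ^ (1 - α) / (1 - α) := by
  have hβ : 0 < 1 - α := by linarith
  induction N with
  | zero => simp [Real.zero_rpow hβ.ne']
  | succ n ih =>
    rw [Finset.sum_range_succ]
    push_cast
    have hn : (0 : ℝ) < (n : ℝ) + 1 := by positivity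
    have hb := rpow_one_add_le_one_add_mul_self (s := -(1 / ((n : ℝ) + 1)))
      (by rw [neg_le_neg_iff, div_le_one hn]; linarith [Nat.cast_nonneg (α := ℝ) n])
      hβ.le (by linarith : 1 - α ≤ 1)
    have e1 : (n : ℝ) ^ (1 - α)
        = ((n : ℝ) + 1) ^ (1 - α) * (1 + -(1 / ((n : ℝ) + 1))) ^ (1 - α) := by
      rw [← Real.mul_rpow hn.le]
      · congr 1; field_simp; ring
      · rw [← sub_eq_add_neg, sub_nonneg, div_le_one hn]; linarith [Nat.cast_nonneg (α := ℝ) n]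
    have e2 : ((n : ℝ) + 1) ^ (1 - α) = ((n : ℝ) + 1) * (((n : ℝ) + 1) ^ α)⁻¹ := by
      rw [Real.rpow_sub hn, Real.rpow_one, div_eq_mul_inv]
    have h3 := mul_le_mul_of_nonneg_left hb (Real.rpow_nonneg hn.le (1 - α))
    rw [← e1] at h3
    have e3 : ((n : ℝ) + 1) ^ (1 - α) * (1 + (1 - α) * -(1 / ((n : ℝ) + 1)))
        = ((n : ℝ) + 1) ^ (1 - α) - (1 - α) * (((n : ℝ) + 1) ^ α)⁻¹ := by
      rw [mul_add, mul_one, e2]; field_simp; ring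
    rw [e3] at h3
    rw [le_div_iff₀ hβ] at ih ⊢
    nlinarith

/-- Since `η ≤ η₀ < 1` keeps the logarithm away from 0, it absorbs the additive 1; this is why the
constant depends on `η₀`. -/
lemma one_add_posLog_le {η₀ η : ℝ} (h0 : 0 < η₀) (h1 : η₀ < 1) (hη : 0 < η) (hle : η ≤ η₀) :
    1 + Real.posLog (1 / η) ≤ (1 + 1 / Real.log (1 / η₀)) * Real.posLog (1 / η) := by
  have hl : 0 < Real.log (1 / η₀) := Real.log_pos (by rw [one_div]; exact (one_lt_inv₀ h0).2 h1)
  have h2 : Real.log (1 / η₀) ≤ Real.posLog (1 / η) :=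
    (Real.log_le_log (by positivity) (one_div_le_one_div_of_le hη hle)).trans (le_max_right _ _)
  have h3 : 1 ≤ 1 / Real.log (1 / η₀) * Real.posLog (1 / η) := by
    rw [one_div_mul_eq_div, le_div_iff₀ hl]; linarith
  linarith

end BDMerging

/-! ### Evaluating the hitting scale in the three regimes of `α`. -/

theorem theorem3p2 (α : ℝ) (hα : 0 ≤ α) :
    (∃ A : ℝ, 0 < A ∧ ∀ N : ℕ, 1 ≤ N →
      ∀ K : ℕ → Matrix (BDMerging.Vtx N) (BDMerging.Vtx N) ℝ,
        (∀ i : ℕ, 1 ≤ i →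
          K i ∈ BDMerging.perturbSet (BDMerging.MHat α N) (BDMerging.epsHat α N)) →
        ∀ η : ℝ, 0 < η →
          (BDMerging.mergingTime K η : ℝ≥0∞) ≤
            ENNReal.ofReal (A * ((N : ℝ) ^ 2 * (1 + Real.posLog (1 / η))))) ∧
    (1 < α → ∀ η₀ : ℝ, 0 < η₀ → η₀ < 1 → ∃ A : ℝ, 0 < A ∧ ∀ N : ℕ, 1 ≤ N →
      ∀ K : ℕ → Matrix (BDMerging.Vtx N) (BDMerging.Vtx N) ℝ,
        (∀ i : ℕ, 1 ≤ i →
          K i ∈ BDMerging.perturbSet (BDMerging.MCheck α N) BDMerging.epsCheck) →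
        ∀ η : ℝ, 0 < η → η ≤ η₀ →
          (BDMerging.mergingTime K η : ℝ≥0∞) ≤
            ENNReal.ofReal
              (A * ((N : ℝ) ^ 2 + (N : ℝ) ^ (1 + α) * Real.posLog (1 / η)))) ∧
    (α = 1 → ∀ η₀ : ℝ, 0 < η₀ → η₀ < 1 → ∃ A : ℝ, 0 < A ∧ ∀ N : ℕ, 2 ≤ N →
      ∀ K : ℕ → Matrix (BDMerging.Vtx N) (BDMerging.Vtx N) ℝ,
        (∀ i : ℕ, 1 ≤ i →
          K i ∈ BDMerging.perturbSet (BDMerging.MCheck α N) BDMerging.epsCheck) →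
        ∀ η : ℝ, 0 < η → η ≤ η₀ →
          (BDMerging.mergingTime K η : ℝ≥0∞) ≤
            ENNReal.ofReal
              (A * ((N : ℝ) ^ 2 + (N : ℝ) ^ 2 * Real.log N * Real.posLog (1 / η)))) ∧
    (α < 1 → ∃ A : ℝ, 0 < A ∧ ∀ N : ℕ, 1 ≤ N →
      ∀ K : ℕ → Matrix (BDMerging.Vtx N) (BDMerging.Vtx N) ℝ,
        (∀ i : ℕ, 1 ≤ i →
          K i ∈ BDMerging.perturbSet (BDMerging.MCheck α N) BDMerging.epsCheck) →
        ∀ η : ℝ, 0 < η →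
          (BDMerging.mergingTime K η : ℝ≥0∞) ≤
            ENNReal.ofReal (A * ((N : ℝ) ^ 2 * (1 + Real.posLog (1 / η))))) := by
  obtain ⟨A, hA, hcheck⟩ := BDMerging.exists_mergingTime_le_check hα
  refine ⟨BDMerging.exists_mergingTime_le_hat hα, fun h1α η₀ h0 h1 => ?_, fun h1α η₀ h0 h1 => ?_,
    fun h1α => ?_⟩
  · have hlog : 0 < Real.log (1 / η₀) :=
      Real.log_pos (by rw [one_div]; exact (one_lt_inv₀ h0).2 h1)
    have hsum : Summable fun j : ℕ => ((j + 1 : ℝ) ^ α)⁻¹ := by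
      have := (summable_nat_add_iff 1).2 (Real.summable_nat_rpow_inv.2 h1α)
      simpa using this
    set S := ∑' j : ℕ, ((j + 1 : ℝ) ^ α)⁻¹ with hS
    have hS0 : 0 ≤ S := tsum_nonneg fun j => by positivity
    refine ⟨A * ((1 + 3 * 2 ^ α * S) * (1 + 1 / Real.log (1 / η₀))), by positivity,
      fun N hN K hK η hη hle => ?_⟩
    have hN1 : (1 : ℝ) ≤ N := by exact_mod_cast hN
    have hN0 : (0 : ℝ) < N := by linarith
    have hL0 : 0 ≤ Real.posLog (1 / η) := Real.posLog_nonneg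
    have hp : (N : ℝ) ^ (1 + α) = N * (N : ℝ) ^ α := by
      rw [Real.rpow_add hN0, Real.rpow_one]
    have hsq : (N : ℝ) ^ 2 ≤ (N : ℝ) ^ (1 + α) := by
      rw [← Real.rpow_natCast]
      exact Real.rpow_le_rpow_of_exponent_le hN1 (by push_cast; linarith)
    have hpos : 0 ≤ 3 * 2 ^ α * S := by positivity
    have hpow : 0 < (N : ℝ) ^ (1 + α) := by positivity
    -- For `α > 1` the series converges, so the scale is `N ^ (1 + α)`, which also dominates `N ^
    -- 2`.
    refine (hcheck hN (G := (1 + 3 * 2 ^ α * S) * (N : ℝ) ^ (1 + α)) (by nlinarith) ?_ hK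
      hη).trans (ENNReal.ofReal_le_ofReal ?_)
    · have h2 : ∑ j ∈ Finset.range N, ((j + 1 : ℝ) ^ α)⁻¹ ≤ S :=
        hsum.sum_le_tsum _ fun j _ => by positivity
      calc 3 * N * (2 * N : ℝ) ^ α * ∑ j ∈ Finset.range N, ((j + 1 : ℝ) ^ α)⁻¹
          ≤ 3 * N * (2 * N : ℝ) ^ α * S := by gcongr
        _ = 3 * 2 ^ α * S * (N : ℝ) ^ (1 + α) := by
          rw [Real.mul_rpow (by norm_num) hN0.le, hp]; ring
        _ ≤ _ := by nlinarith
    · have h3 := BDMerging.one_add_posLog_le h0 h1 hη hle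
      calc A * ((1 + 3 * 2 ^ α * S) * (N : ℝ) ^ (1 + α) * (1 + Real.posLog (1 / η)))
          ≤ A * ((1 + 3 * 2 ^ α * S) * (N : ℝ) ^ (1 + α)
            * ((1 + 1 / Real.log (1 / η₀)) * Real.posLog (1 / η))) := by gcongr
        _ = A * ((1 + 3 * 2 ^ α * S) * (1 + 1 / Real.log (1 / η₀)))
            * ((N : ℝ) ^ (1 + α) * Real.posLog (1 / η)) := by ring
        _ ≤ _ := by
          refine mul_le_mul_of_nonneg_left ?_ (by positivity)
          nlinarith [sq_nonneg (N : ℝ)]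
  · subst h1α
    have hlog : 0 < Real.log (1 / η₀) :=
      Real.log_pos (by rw [one_div]; exact (one_lt_inv₀ h0).2 h1)
    have hlog2 : 0 < Real.log 2 := Real.log_pos (by norm_num)
    refine ⟨A * (6 * (1 + 1 / Real.log 2) * (1 + 1 / Real.log (1 / η₀))), by positivity,
      fun N hN K hK η hη hle => ?_⟩
    have hN1 : (2 : ℝ) ≤ N := by exact_mod_cast hN
    have hN0 : (0 : ℝ) < N := by linarith
    have hL0 : 0 ≤ Real.posLog (1 / η) := Real.posLog_nonneg
    have hlogN : Real.log 2 ≤ Real.log N := Real.log_le_log (by norm_num) hN1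
    -- `N ≥ 2` is needed here: it lets `log N` absorb the 1 left by the harmonic sum.
    have h2 : 1 + Real.log N ≤ (1 + 1 / Real.log 2) * Real.log N := by
      have : 1 ≤ 1 / Real.log 2 * Real.log N := by
        rw [one_div_mul_eq_div, le_div_iff₀ hlog2]; linarith
      linarith
    refine (hcheck (by omega) (G := 6 * ((N : ℝ) ^ 2 * (1 + Real.log N)))
      (by nlinarith [sq_nonneg (N : ℝ), mul_nonneg (sq_nonneg (N : ℝ)) (hlog2.le.trans hlogN)])
      ?_ hK hη).trans (ENNReal.ofReal_le_ofReal ?_)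
    · have h3 := harmonic_le_one_add_log N
      have h4 : ∑ j ∈ Finset.range N, ((j + 1 : ℝ) ^ (1 : ℝ))⁻¹ = (harmonic N : ℝ) := by
        simp [harmonic]
      rw [h4, Real.rpow_one]
      calc 3 * N * (2 * N : ℝ) * (harmonic N : ℝ) ≤ 3 * N * (2 * N : ℝ) * (1 + Real.log N) := by
            gcongr
        _ = _ := by ring
    · have h3 := BDMerging.one_add_posLog_le h0 h1 hη hle
      have hlogN0 : 0 ≤ Real.log N := hlog2.le.trans hlogN
      calc A * (6 * ((N : ℝ) ^ 2 * (1 + Real.log N)) * (1 + Real.posLog (1 / η)))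
          ≤ A * (6 * ((N : ℝ) ^ 2 * ((1 + 1 / Real.log 2) * Real.log N))
            * ((1 + 1 / Real.log (1 / η₀)) * Real.posLog (1 / η))) := by gcongr
        _ = A * (6 * (1 + 1 / Real.log 2) * (1 + 1 / Real.log (1 / η₀)))
            * ((N : ℝ) ^ 2 * Real.log N * Real.posLog (1 / η)) := by ring
        _ ≤ _ := by
          refine mul_le_mul_of_nonneg_left ?_ (by positivity)
          nlinarith [sq_nonneg (N : ℝ)]
  · have hβ : 0 < 1 - α := by linarith
    refine ⟨A * (1 + 3 * 2 ^ α / (1 - α)), by positivity, fun N hN K hK η hη => ?_⟩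
    have hN1 : (1 : ℝ) ≤ N := by exact_mod_cast hN
    have hN0 : (0 : ℝ) < N := by linarith
    have hpos : 0 ≤ 3 * 2 ^ α / (1 - α) := by positivity
    refine (hcheck hN (G := (1 + 3 * 2 ^ α / (1 - α)) * (N : ℝ) ^ 2)
      (by nlinarith [sq_nonneg (N : ℝ)]) ?_ hK hη).trans
      (ENNReal.ofReal_le_ofReal (le_of_eq (by ring)))
    -- For `α < 1` the sum is of order `N ^ (1 - α)`, which cancels the growth of the weight and
    -- leaves `N ^ 2`.
    have hp : (N : ℝ) ^ α * (N : ℝ) ^ (1 - α) = N := by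
      rw [← Real.rpow_add hN0]; simp
    calc 3 * N * (2 * N : ℝ) ^ α * ∑ j ∈ Finset.range N, ((j + 1 : ℝ) ^ α)⁻¹
        ≤ 3 * N * (2 * N : ℝ) ^ α * ((N : ℝ) ^ (1 - α) / (1 - α)) := by
          gcongr; exact BDMerging.sum_inv_rpow_le hα h1α N
      _ = 3 * 2 ^ α / (1 - α) * (N * ((N : ℝ) ^ α * (N : ℝ) ^ (1 - α))) := by
          rw [Real.mul_rpow (by norm_num) hN0.le]; ring
      _ = 3 * 2 ^ α / (1 - α) * (N : ℝ) ^ 2 := by rw [hp]; ring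
      _ ≤ _ := by nlinarith [sq_nonneg (N : ℝ)]
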